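/- Let $\mathbb{K}$ be a field of characteristic zero and $\mathcal{D}$ a nonempty set. A rooted forest is a finite graph whose connected components are trees, each with a distinguished root; its edges are decorated by elements of $\mathcal{D}$, and forests are taken up to isomorphism. For a rooted forest $F$ with edge set $E(F)$ and $\mathbf{e}\subseteq E(F)$, let $Part_{\mathbf{e}}(F)$ be the forest with all the vertices of $F$ and the edges in $\mathbf{e}$ only, and let $Cont_{\mathbf{e}}(F)$ be the forest obtained from $F$ by contracting each edge in $\mathbf{e}$ (decorations of the remaining edges are kept). Write $\overline{\mathbf{e}}=E(F)\setminus\mathbf{e}$. Let $\mathbf{C}_{CK}^{\mathcal{D}}$ be the algebra spanned by these forests, with concatenation as product and with the one-vertex tree identified with the unit $1$, with the coproduct $\Delta(F)=\sum_{\mathbf{e}\subseteq E(F)}Part_{\mathbf{e}}(F)\otimes Cont_{\mathbf{e}}(F)$ and the counit that is $1$ on forests without edges and $0$ on the other forests. Let $\mathbf{Sh}^{\mathcal{D}}$ be the space spanned by the words with letters in $\mathcal{D}$, with the shuffle product, the deconcatenation coproduct $\Delta(v_1\cdots v_n)=\sum_{i=0}^n (v_1\cdots v_i)\otimes(v_{i+1}\cdots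 v_n)$, and the counit given by the coefficient of the empty word. Let $\mathbb{T}$ be the set of trees in $\mathbf{C}_{CK}^{\mathcal{D}}$ with at least one edge, $i:\mathbb{K}(\mathbb{T})\to\mathbf{C}_{CK}^{\mathcal{D}}$ the inclusion of the space spanned by $\mathbb{T}$, and $\pi:\mathbf{Sh}^{\mathcal{D}}\to\mathbb{K}(\mathcal{D})$ the projection onto the space spanned by the one-letter words. Let $F$ be a forest with at least one edge. A generalized partition of $F$ is a $k$-tuple $(\mathbf{e}_1,\dots,\mathbf{e}_k)$ of subsets of $E(F)$, $1\le k\le |E(F)|$, such that: 1. the $\mathbf{e}_i$ are nonempty and pairwise disjoint, and $\bigcup_i\mathbf{e}_i=E(F)$; 2. for each $i$, the edges in $\mathbf{e}_i$ belong to the same connected component of $F$; 3. if $v$ and $w$ are ends of edges in $\mathbf{e}_i$ and the shortest path in $F$ between $v$ and $w$ contains an edge in $\mathbf{e}_j$ with $j\neq i$, then $j<i$. Let $\mathcal{P}(F)$ be the set of generalized partitions of $F$. For $(\mathbf{e}_1,\dots,\mathbf{e}_k)\in\mathcal{P}(F)$, each $Cont_{\overline{\mathbf{e}_i}}(F)$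 is an element of $\mathbb{T}$ (one-vertex trees being the unit). **Statement.** Let $\varphi:\mathbb{K}(\mathbb{T})\to\mathbb{K}(\mathcal{D})$ be a linear map. There is a unique Hopf algebra morphism $\Phi:\mathbf{C}_{CK}^{\mathcal{D}}\to\mathbf{Sh}^{\mathcal{D}}$ such that $\pi\circ\Phi\circ i=\varphi$, and for every forest $F$ with at least one edge $$\Phi(F)=\sum_{(\mathbf{e}_1,\dots,\mathbf{e}_k)\in\mathcal{P}(F)}\varphi(Cont_{\overline{\mathbf{e}_1}}(F))\cdots\varphi(Cont_{\overline{\mathbf{e}_k}}(F)),$$ where $x_1\cdots x_k\in\mathbf{Sh}^{\mathcal{D}}$, for $x_1,\dots,x_k\in\mathbb{K}(\mathcal{D})$, is the word with letters $x_1,\dots,x_k$, extended linearly in each letter. -/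

import Mathlib

open scoped TensorProduct

namespace ContractionForest

/-- A rooted forest with vertex set `V` whose edges are decorated by `D`.  `parent v = none` says
that `v` is a root; `parent v = some (w, d)` says that there is an edge, decorated by `d`, from `v`
down to `w`.  Following the edges downwards always ends at a root. -/
structure RForest (D : Type*) (V : Type*) where
  parent : V → Option (V × D)
  wf : WellFounded fun w v : V => ∃ d, parent v = some (w, d)

namespace RForest

section Basic

variable {D V W V' W' : Type*}

@[ext] theorem ext' {F G : RForest D V} (h : F.parent = G.parent) : F = G := by
  cases F; cases G; cases h; rfl

/-- The root of the tree of `F` that contains `v`. -/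
noncomputable def rootOf (F : RForest D V) : V → V :=
  F.wf.fix fun v ih =>
    match h : F.parent v with
    | none => v
    | some (w, d) => ih w ⟨d, h⟩

theorem rootOf_of_none (F : RForest D V) {v : V} (h : F.parent v = none) : F.rootOf v = v := by
  rw [rootOf, WellFounded.fix_eq]
  split
  · rfl
  · simp_all

theorem rootOf_of_some (F : RForest D V) {v w : V} {d : D} (h : F.parent v = some (w, d)) :
    F.rootOf v = F.rootOf w := by
  rw [rootOf, WellFounded.fix_eq]
  split
  · simp_all
  · rename_i w' d' h'
    rw [h] at h'
    cases h'
    rfl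

theorem induct (F : RForest D V) {P : V → Prop} (h0 : ∀ v, F.parent v = none → P v)
    (h1 : ∀ v w d, F.parent v = some (w, d) → P w → P v) (v : V) : P v := by
  induction v using F.wf.induction with
  | _ v ih =>
    rcases h : F.parent v with _ | ⟨w, d⟩
    · exact h0 v h
    · exact h1 v w d h (ih w ⟨d, h⟩)

theorem parent_rootOf (F : RForest D V) (v : V) : F.parent (F.rootOf v) = none := by
  induction v using F.induct with
  | h0 v h => rw [F.rootOf_of_none h, h]
  | h1 v w d h ih => rw [F.rootOf_of_some h, ih]

/-- An isomorphism of rooted forests that preserves the decorations of the edges. -/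
def IsIso (F : RForest D V) (G : RForest D W) (σ : V ≃ W) : Prop :=
  ∀ v, G.parent (σ v) = (F.parent v).map (Prod.map σ id)

/-- Two rooted forests are isomorphic. -/
def Isom (F : RForest D V) (G : RForest D W) : Prop := ∃ σ : V ≃ W, F.IsIso G σ

theorem Isom.refl (F : RForest D V) : F.Isom F := ⟨Equiv.refl V, fun v => by simp⟩

theorem IsIso.symm {F : RForest D V} {G : RForest D W} {σ : V ≃ W} (h : F.IsIso G σ) :
    G.IsIso F σ.symm := by
  intro w
  have := h (σ.symm w)
  rw [Equiv.apply_symm_apply] at this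
  rw [this, Option.map_map]
  simp [Function.comp_def, Prod.map]

theorem Isom.symm {F : RForest D V} {G : RForest D W} (h : F.Isom G) : G.Isom F :=
  h.elim fun _ hσ => ⟨_, hσ.symm⟩

theorem Isom.trans {F : RForest D V} {G : RForest D W} {H : RForest D V'} (h : F.Isom G)
    (h' : G.Isom H) : F.Isom H := by
  obtain ⟨σ, hσ⟩ := h
  obtain ⟨τ, hτ⟩ := h'
  refine ⟨σ.trans τ, fun v => ?_⟩
  rw [Equiv.trans_apply, hτ, hσ, Option.map_map]
  rfl

/-- Renaming the vertices along a bijection. -/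
def relabel (F : RForest D V) (σ : V ≃ W) : RForest D W where
  parent w := (F.parent (σ.symm w)).map (Prod.map σ id)
  wf := by
    refine Subrelation.wf ?_ (InvImage.wf σ.symm F.wf)
    rintro w v ⟨d, h⟩
    simp only [Option.map_eq_some_iff, Prod.exists, Prod.map_apply, Prod.mk.injEq] at h
    obtain ⟨x, d', h, rfl, -⟩ := h
    exact ⟨d', by simpa using h⟩

theorem isom_relabel (F : RForest D V) (σ : V ≃ W) : F.Isom (F.relabel σ) :=
  ⟨σ, fun v => by simp [relabel]⟩

/-- The concatenation (disjoint union) of two rooted forests. -/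
def add (F : RForest D V) (G : RForest D W) : RForest D (V ⊕ W) where
  parent := Sum.elim (fun v => (F.parent v).map (Prod.map Sum.inl id))
    (fun w => (G.parent w).map (Prod.map Sum.inr id))
  wf := by
    refine ⟨fun x => ?_⟩
    rcases x with v | w
    · induction v using F.wf.induction with
      | _ v ih =>
        refine ⟨_, ?_⟩
        rintro y ⟨d, h⟩
        simp only [Sum.elim_inl, Option.map_eq_some_iff, Prod.exists, Prod.map_apply,
          Prod.mk.injEq] at h
        obtain ⟨x, d', h, rfl, -⟩ := h
        exact ih x ⟨d', h⟩
    · induction w using G.wf.induction with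
      | _ v ih =>
        refine ⟨_, ?_⟩
        rintro y ⟨d, h⟩
        simp only [Sum.elim_inr, Option.map_eq_some_iff, Prod.exists, Prod.map_apply,
          Prod.mk.injEq] at h
        obtain ⟨x, d', h, rfl, -⟩ := h
        exact ih x ⟨d', h⟩

/-- The forest without edges on a given set of vertices. -/
def edgeless (D V : Type*) : RForest D V where
  parent _ := none
  wf := ⟨fun x => ⟨_, fun y h => by simp at h⟩⟩

/-- The tree with one vertex. -/
def dot (D : Type*) : RForest D Unit := edgeless D Unit

/-- The empty forest. -/
def empty (D : Type*) : RForest D (Fin 0) := edgeless D (Fin 0)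

/-- The underlying graph of a rooted forest. -/
def graph (F : RForest D V) : SimpleGraph V where
  Adj v w := (∃ d, F.parent v = some (w, d)) ∨ ∃ d, F.parent w = some (v, d)
  symm := ⟨fun _ _ h => h.symm⟩
  loopless := ⟨fun v h => F.wf.irrefl.irrefl v (by simpa using h)⟩

/-- A rooted tree is a rooted forest with exactly one root. -/
def IsTree (F : RForest D V) : Prop := ∃! r, F.parent r = none

end Basic

section Contraction

variable {D V W V' W' : Type*} [DecidableEq V] [DecidableEq W]

/-- The set of edges of `F`.  An edge is named by its upper end, so that the edges are the vertices
that are not roots. -/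
def edges (F : RForest D V) [Fintype V] : Finset V :=
  Finset.univ.filter fun v => (F.parent v).isSome

/-- `Part_e(F)`: keep all the vertices of `F`, and only the edges in `e`. -/
def part (F : RForest D V) (e : Finset V) : RForest D V where
  parent v := if v ∈ e then F.parent v else none
  wf := by
    refine Subrelation.wf ?_ F.wf
    rintro w v ⟨d, h⟩
    by_cases hv : v ∈ e
    · exact ⟨d, by simpa [hv] using h⟩
    · simp [hv] at h

/-- The vertices of `Cont_e(F)`: the connected components of `Part_e(F)`, each of them represented
by its root. -/
abbrev ContVertex (F : RForest D V) (e : Finset V) : Type _ :=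
  {v : V // (F.part e).parent v = none}

/-- The vertex of `Cont_e(F)` to which the vertex `v` of `F` is contracted. -/
noncomputable def toCont (F : RForest D V) (e : Finset V) (v : V) : F.ContVertex e :=
  ⟨(F.part e).rootOf v, (F.part e).parent_rootOf v⟩

/-- `Cont_e(F)`: contract each edge in `e`, identifying its two ends.  The remaining edges keep
their decorations. -/
noncomputable def cont (F : RForest D V) (e : Finset V) : RForest D (F.ContVertex e) where
  parent r := (F.parent r.1).map (Prod.map (F.toCont e) id)
  wf := by
    have key : ∀ x : V, Acc (fun w v : F.ContVertex e =>
        ∃ d, (F.parent v.1).map (Prod.map (F.toCont e) id) = some (w, d)) (F.toCont e x) := by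
      intro x
      induction x using F.induct with
      | h0 v h =>
        have hv : (F.part e).parent v = none := by simp [part, h]
        refine ⟨_, ?_⟩
        rintro y ⟨d, hy⟩
        have : (F.toCont e v).1 = v := (F.part e).rootOf_of_none hv
        rw [this, h] at hy
        simp at hy
      | h1 v w d h ih =>
        by_cases hv : v ∈ e
        · have h' : (F.part e).parent v = some (w, d) := by simp [part, hv, h]
          have : F.toCont e v = F.toCont e w := Subtype.ext ((F.part e).rootOf_of_some h')
          rw [this]
          exact ih
        · have h' : (F.part e).parent v = none := by simp [part, hv]
          refine ⟨_, ?_⟩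
          rintro y ⟨d', hy⟩
          have : (F.toCont e v).1 = v := (F.part e).rootOf_of_none h'
          rw [this, h] at hy
          simp only [Option.map_some, Prod.map_apply, Option.some.injEq, Prod.mk.injEq] at hy
          rw [← hy.1]
          exact ih
    refine ⟨fun r => ?_⟩
    have : F.toCont e r.1 = r := Subtype.ext ((F.part e).rootOf_of_none r.2)
    rw [← this]
    exact key r.1

/-- The vertices of the subgraph of `F` formed by the edges in `e`: both ends of these edges. -/
def ends (F : RForest D V) (e : Finset V) : Set V :=
  {x | x ∈ e ∨ ∃ v ∈ e, ∃ d, F.parent v = some (x, d)}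

/-- `(e_1, …, e_k)` is a generalized partition of `F`. -/
structure IsGenPartition (F : RForest D V) [Fintype V] {k : ℕ} (p : Fin k → Finset V) : Prop where
  nonempty : ∀ i, (p i).Nonempty
  disjoint : ∀ i j, i ≠ j → Disjoint (p i) (p j)
  union : Finset.univ.biUnion p = F.edges
  /-- The edges of a block lie in one connected component of `F`. -/
  component : ∀ i, ∀ u ∈ p i, ∀ v ∈ p i, F.graph.Reachable u v
  /-- An edge of the block `j` on a shortest path of `F` between two vertices of the edges of the
  block `i` can only occur for `j ≤ i`. -/
  path : ∀ i, ∀ v ∈ F.ends (p i), ∀ w ∈ F.ends (p i), ∀ q : F.graph.Walk v w,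
    q.length = F.graph.dist v w →
      ∀ j, ∀ u ∈ p j, ∀ t d, F.parent u = some (t, d) → s(u, t) ∈ q.edges → j ≤ i

end Contraction

section Classes

variable {D V W V' W' : Type*}

theorem IsIso.rootOf {F : RForest D V} {G : RForest D W} {σ : V ≃ W} (h : F.IsIso G σ) (v : V) :
    G.rootOf (σ v) = σ (F.rootOf v) := by
  induction v using F.induct with
  | h0 v hv => rw [F.rootOf_of_none hv, G.rootOf_of_none (by rw [h v, hv]; rfl)]
  | h1 v w d hv ih =>
    rw [F.rootOf_of_some hv, ← ih]
    exact G.rootOf_of_some (d := d) (by rw [h v, hv]; rfl)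

theorem IsIso.part [DecidableEq V] [DecidableEq W] {F : RForest D V} {G : RForest D W} {σ : V ≃ W}
    (h : F.IsIso G σ) (e : Finset V) :
    (F.part e).IsIso (G.part (e.map σ.toEmbedding)) σ := by
  intro v
  by_cases hv : v ∈ e
  · simp [RForest.part, hv, h v]
  · simp [RForest.part, hv]

theorem IsIso.cont [DecidableEq V] [DecidableEq W] {F : RForest D V} {G : RForest D W} {σ : V ≃ W}
    (h : F.IsIso G σ) (e : Finset V) :
    (F.cont e).Isom (G.cont (e.map σ.toEmbedding)) := by
  have hp := h.part e
  refine ⟨σ.subtypeEquiv fun v => by rw [hp v]; simp, fun v => ?_⟩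
  have hσ : ∀ x, G.toCont (e.map σ.toEmbedding) (σ x) =
      (σ.subtypeEquiv fun v => by rw [hp v]; simp) (F.toCont e x) :=
    fun x => Subtype.ext (hp.rootOf x)
  change (G.parent (σ v.1)).map _ = Option.map _ ((F.parent v.1).map _)
  rw [h v.1]
  rcases F.parent v.1 with _ | ⟨w, d⟩
  · rfl
  · simp [hσ]

theorem Isom.add {F : RForest D V} {G : RForest D W} {F' : RForest D V'} {G' : RForest D W'}
    (h : F.Isom F') (h' : G.Isom G') : (F.add G).Isom (F'.add G') := by
  obtain ⟨σ, hσ⟩ := h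
  obtain ⟨τ, hτ⟩ := h'
  refine ⟨Equiv.sumCongr σ τ, ?_⟩
  rintro (v | v)
  · simp only [RForest.add, Equiv.sumCongr_apply, Sum.map_inl, Sum.elim_inl, hσ v, Option.map_map]
    rfl
  · simp only [RForest.add, Equiv.sumCongr_apply, Sum.map_inr, Sum.elim_inr, hτ v, Option.map_map]
    rfl

theorem add_comm_isom (F : RForest D V) (G : RForest D W) : (F.add G).Isom (G.add F) := by
  refine ⟨Equiv.sumComm V W, ?_⟩
  rintro (v | v)
  · simp only [RForest.add, Equiv.sumComm_apply, Sum.swap_inl, Sum.elim_inl, Sum.elim_inr,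
      Option.map_map]
    rfl
  · simp only [RForest.add, Equiv.sumComm_apply, Sum.swap_inr, Sum.elim_inl, Sum.elim_inr,
      Option.map_map]
    rfl

theorem add_assoc_isom (F : RForest D V) (G : RForest D W) (H : RForest D V') :
    ((F.add G).add H).Isom (F.add (G.add H)) := by
  refine ⟨Equiv.sumAssoc V W V', ?_⟩
  rintro ((v | v) | v)
  all_goals
    simp only [RForest.add, Equiv.sumAssoc_apply_inl_inl, Equiv.sumAssoc_apply_inl_inr,
      Equiv.sumAssoc_apply_inr, Sum.elim_inl, Sum.elim_inr, Option.map_map]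
    rfl

theorem add_edgeless_isom [IsEmpty W] (F : RForest D V) : (F.add (edgeless D W)).Isom F := by
  refine ⟨Equiv.sumEmpty V W, ?_⟩
  rintro (v | v)
  · simp only [RForest.add, Equiv.sumEmpty_apply_inl, Sum.elim_inl, Option.map_map]
    rcases F.parent v with _ | ⟨w, d⟩ <;> simp
  · exact isEmptyElim v

end Classes

end RForest

/-- Isomorphism of finite rooted forests with decorated edges. -/
instance forestSetoid (D : Type*) : Setoid (Σ n : ℕ, RForest D (Fin n)) where
  r F G := F.2.Isom G.2
  iseqv := ⟨fun F => .refl F.2, fun h => h.symm, fun h h' => h.trans h'⟩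

/-- The isomorphism classes of finite rooted forests with edges decorated by `D`. -/
def FClass (D : Type*) : Type _ := Quotient (forestSetoid D)

/-- The isomorphism class of a finite rooted forest. -/
noncomputable def RForest.cls {D V : Type*} [Fintype V] (F : RForest D V) : FClass D :=
  Quotient.mk _ ⟨Fintype.card V, F.relabel (Fintype.equivFin V)⟩

section FClass

variable {D V W : Type*} [Fintype V] [Fintype W]

theorem RForest.cls_eq_iff {F : RForest D V} {G : RForest D W} : F.cls = G.cls ↔ F.Isom G := by
  refine Quotient.eq.trans ⟨fun h => ?_, fun h => ?_⟩
  · exact ((F.isom_relabel _).trans h).trans (G.isom_relabel _).symm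
  · exact ((F.isom_relabel _).symm.trans h).trans (G.isom_relabel _)

theorem FClass.mk_eq {n : ℕ} (F : RForest D (Fin n)) :
    (Quotient.mk _ ⟨n, F⟩ : FClass D) = F.cls :=
  Quotient.sound (F.isom_relabel _)

theorem FClass.ind' {P : FClass D → Prop} (h : ∀ n (F : RForest D (Fin n)), P F.cls)
    (c : FClass D) : P c := by
  induction c using Quotient.inductionOn with
  | _ F => exact (FClass.mk_eq F.2) ▸ h F.1 F.2

/-- The product of isomorphism classes is given by concatenation. -/
noncomputable instance : Mul (FClass D) where
  mul := Quotient.lift₂ (fun F G => (F.2.add G.2).cls) fun _ _ _ _ h h' =>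
    RForest.cls_eq_iff.2 (h.add h')

theorem RForest.cls_add (F : RForest D V) (G : RForest D W) :
    (F.add G).cls = F.cls * G.cls :=
  RForest.cls_eq_iff.2 ((F.isom_relabel _).add (G.isom_relabel _))

noncomputable instance : CommMonoid (FClass D) where
  one := (RForest.empty D).cls
  mul_assoc a b c := by
    induction a using FClass.ind' with | _ n F
    induction b using FClass.ind' with | _ m G
    induction c using FClass.ind' with | _ l H
    simp only [← RForest.cls_add]
    exact RForest.cls_eq_iff.2 (F.add_assoc_isom G H)
  mul_comm a b := by
    induction a using FClass.ind' with | _ n F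
    induction b using FClass.ind' with | _ m G
    simp only [← RForest.cls_add]
    exact RForest.cls_eq_iff.2 (F.add_comm_isom G)
  mul_one a := by
    induction a using FClass.ind' with | _ n F
    exact (F.cls_add (RForest.empty D)).symm.trans (RForest.cls_eq_iff.2 F.add_edgeless_isom)
  one_mul a := by
    induction a using FClass.ind' with | _ n F
    exact ((RForest.empty D).cls_add F).symm.trans
      (RForest.cls_eq_iff.2 (((RForest.empty D).add_comm_isom F).trans F.add_edgeless_isom))

theorem FClass.one_def : (1 : FClass D) = (RForest.empty D).cls := rfl

end FClass

/-- The congruence on forests generated by identifying the tree with one vertex with the unit (the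
empty forest). -/
noncomputable def dotCon (D : Type*) : Con (FClass D) :=
  conGen fun x y => x = (RForest.dot D).cls ∧ y = 1

/-- The forests, where the tree with one vertex is identified with the unit. -/
abbrev RClass (D : Type*) : Type _ := (dotCon D).Quotient

/-- The class of a finite rooted forest, where the tree with one vertex is the unit. -/
noncomputable def RForest.rcls {D V : Type*} [Fintype V] (F : RForest D V) : RClass D :=
  (F.cls : (dotCon D).Quotient)

namespace RForest

section Coprod

variable {D V W : Type*}

theorem rootOf_add_inl (F : RForest D V) (G : RForest D W) (v : V) :
    (F.add G).rootOf (Sum.inl v) = Sum.inl (F.rootOf v) := by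
  induction v using F.induct with
  | h0 v h => rw [F.rootOf_of_none h, rootOf_of_none _ (by simp [add, h])]
  | h1 v w d h ih =>
    rw [F.rootOf_of_some h, ← ih]
    exact (F.add G).rootOf_of_some (d := d) (by simp [add, h])

theorem rootOf_add_inr (F : RForest D V) (G : RForest D W) (v : W) :
    (F.add G).rootOf (Sum.inr v) = Sum.inr (G.rootOf v) := by
  induction v using G.induct with
  | h0 v h => rw [G.rootOf_of_none h, rootOf_of_none _ (by simp [add, h])]
  | h1 v w d h ih =>
    rw [G.rootOf_of_some h, ← ih]
    exact (F.add G).rootOf_of_some (d := d) (by simp [add, h])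

variable [DecidableEq V] [DecidableEq W]

theorem part_add (F : RForest D V) (G : RForest D W) (e : Finset V) (f : Finset W) :
    (F.add G).part (e.disjSum f) = (F.part e).add (G.part f) := by
  ext1
  funext x
  rcases x with v | v
  · by_cases hv : v ∈ e <;> simp [part, add, hv]
  · by_cases hv : v ∈ f <;> simp [part, add, hv]

theorem cont_add (F : RForest D V) (G : RForest D W) (e : Finset V) (f : Finset W) :
    ((F.add G).cont (e.disjSum f)).Isom ((F.cont e).add (G.cont f)) := by
  have hl : ∀ v, ((F.add G).part (e.disjSum f)).parent (Sum.inl v) = none ↔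
      (F.part e).parent v = none := by
    intro v; rw [part_add]; simp [add]
  have hr : ∀ v, ((F.add G).part (e.disjSum f)).parent (Sum.inr v) = none ↔
      (G.part f).parent v = none := by
    intro v; rw [part_add]; simp [add]
  let τ : (F.ContVertex e) ⊕ (G.ContVertex f) ≃ (F.add G).ContVertex (e.disjSum f) :=
    ((Equiv.subtypeSum).trans (Equiv.sumCongr (Equiv.subtypeEquivRight hl)
      (Equiv.subtypeEquivRight hr))).symm
  have tl : ∀ v, (F.add G).toCont (e.disjSum f) (Sum.inl v) = τ (Sum.inl (F.toCont e v)) := by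
    intro v
    apply Subtype.ext
    change ((F.add G).part (e.disjSum f)).rootOf (Sum.inl v) = Sum.inl ((F.part e).rootOf v)
    rw [part_add, rootOf_add_inl]
  have tr : ∀ v, (F.add G).toCont (e.disjSum f) (Sum.inr v) = τ (Sum.inr (G.toCont f v)) := by
    intro v
    apply Subtype.ext
    change ((F.add G).part (e.disjSum f)).rootOf (Sum.inr v) = Sum.inr ((G.part f).rootOf v)
    rw [part_add, rootOf_add_inr]
  refine Isom.symm ⟨τ, ?_⟩
  rintro (v | v)
  · change ((F.parent v.1).map (Prod.map Sum.inl id)).map _ =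
      Option.map _ (((F.parent v.1).map _).map _)
    rcases F.parent v.1 with _ | ⟨w, d⟩
    · rfl
    · simp [tl]
  · change ((G.parent v.1).map (Prod.map Sum.inr id)).map _ =
      Option.map _ (((G.parent v.1).map _).map _)
    rcases G.parent v.1 with _ | ⟨w, d⟩
    · rfl
    · simp [tr]

end Coprod

section Classes

variable {D V W : Type*} [Fintype V] [Fintype W]

theorem mem_edges {F : RForest D V} {v : V} : v ∈ F.edges ↔ (F.parent v).isSome := by
  simp [edges]

theorem edges_add (F : RForest D V) (G : RForest D W) :
    (F.add G).edges = F.edges.disjSum G.edges := by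
  ext x
  rcases x with v | v <;> simp [mem_edges, add]

theorem IsIso.edges {F : RForest D V} {G : RForest D W} {σ : V ≃ W} (h : F.IsIso G σ) :
    G.edges = F.edges.map σ.toEmbedding := by
  ext w
  obtain ⟨v, rfl⟩ := σ.surjective w
  simp [RForest.edges, h v]

theorem rcls_eq {F : RForest D V} {G : RForest D W} (h : F.Isom G) : F.rcls = G.rcls :=
  congrArg _ (cls_eq_iff.2 h)

theorem rcls_add (F : RForest D V) (G : RForest D W) : (F.add G).rcls = F.rcls * G.rcls := by
  simp only [rcls, cls_add, Con.coe_mul]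

theorem rcls_dot : (dot D).rcls = 1 :=
  (Con.eq _).2 (Con.le_conGen _ _ ⟨rfl, rfl⟩)

theorem rcls_edgeless (D : Type*) (V : Type*) [Fintype V] : (edgeless D V).rcls = 1 := by
  refine Fintype.induction_empty_option (P := fun V _ => (edgeless D V).rcls = 1)
    (fun α β _ e h => ?_) ?_ (fun α _ h => ?_) V
  · let _ := Fintype.ofEquiv β e.symm
    exact (rcls_eq ⟨e, fun v => rfl⟩ : (edgeless D α).rcls = (edgeless D β).rcls) ▸ h
  · exact congrArg _ (cls_eq_iff.2 ⟨Equiv.equivOfIsEmpty _ _, fun v => rfl⟩)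
  · have : (edgeless D (Option α)).Isom ((edgeless D α).add (dot D)) := by
      refine ⟨Equiv.optionEquivSumPUnit α, fun v => ?_⟩
      rcases v with _ | v <;> rfl
    rw [rcls_eq this, rcls_add, h, rcls_dot, one_mul]

end Classes

end RForest

/-- The algebra spanned by the rooted forests with edges decorated by `D`, where the tree with one
vertex is identified with the unit.  The product is the concatenation. -/
def CCK (K D : Type*) [Field K] : Type _ := MonoidAlgebra K (RClass D)

section CCK

variable (K : Type*) [Field K] {D V W : Type*}

noncomputable instance : CommRing (CCK K D) :=
  inferInstanceAs (CommRing (MonoidAlgebra K (RClass D)))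

noncomputable instance : Algebra K (CCK K D) :=
  inferInstanceAs (Algebra K (MonoidAlgebra K (RClass D)))

/-- The basis of `CCK K D` given by the forests. -/
noncomputable def CCK.of (D : Type*) : RClass D →* CCK K D := MonoidAlgebra.of K (RClass D)

variable [Fintype V] [Fintype W]

/-- A finite rooted forest as an element of `CCK K D`. -/
noncomputable def RForest.toCCK (F : RForest D V) : CCK K D := CCK.of K D F.rcls

theorem RForest.toCCK_eq {F : RForest D V} {G : RForest D W} (h : F.Isom G) :
    F.toCCK K = G.toCCK K :=
  congrArg _ (RForest.rcls_eq h)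

theorem RForest.toCCK_add (F : RForest D V) (G : RForest D W) :
    (F.add G).toCCK K = F.toCCK K * G.toCCK K := by
  simp only [RForest.toCCK, RForest.rcls_add, map_mul]

variable [DecidableEq V] [DecidableEq W]

/-- The contraction coproduct of a forest: the sum of `Part_e(F) ⊗ Cont_e(F)` over all sets `e` of
edges of `F`. -/
noncomputable def RForest.coprod (F : RForest D V) : CCK K D ⊗[K] CCK K D :=
  ∑ e ∈ F.edges.powerset, (F.part e).toCCK K ⊗ₜ[K] (F.cont e).toCCK K

theorem RForest.coprod_eq {F : RForest D V} {G : RForest D W} (h : F.Isom G) :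
    F.coprod K = G.coprod K := by
  obtain ⟨σ, hσ⟩ := h
  rw [RForest.coprod, RForest.coprod, hσ.edges]
  refine Finset.sum_bij (fun e _ => e.map σ.toEmbedding) (fun e he => ?_) (fun e _ f _ h => ?_)
    (fun f hf => ?_) (fun e he => ?_)
  · simpa using he
  · exact Finset.map_injective _ h
  · refine ⟨f.map σ.symm.toEmbedding, ?_, ?_⟩
    · rw [Finset.mem_powerset] at hf ⊢
      intro v hv
      rw [Finset.mem_map_equiv, Equiv.symm_symm] at hv
      simpa using hf hv
    · ext w; simp
  · rw [RForest.toCCK_eq K ⟨σ, hσ.part e⟩, RForest.toCCK_eq K (hσ.cont e)]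

theorem RForest.coprod_add (F : RForest D V) (G : RForest D W) :
    (F.add G).coprod K = F.coprod K * G.coprod K := by
  rw [RForest.coprod, RForest.coprod, RForest.coprod, Finset.sum_mul_sum, ← Finset.sum_product',
    RForest.edges_add]
  symm
  refine Finset.sum_bij (fun e _ => e.1.disjSum e.2) (fun e he => ?_) (fun e _ f _ h => ?_)
    (fun f hf => ?_) (fun e he => ?_)
  · rw [Finset.mem_product, Finset.mem_powerset, Finset.mem_powerset] at he
    exact Finset.mem_powerset.2 (Finset.disjSum_mono he.1 he.2)
  · have h1 := congrArg Finset.toLeft h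
    have h2 := congrArg Finset.toRight h
    simp only [Finset.toLeft_disjSum, Finset.toRight_disjSum] at h1 h2
    exact Prod.ext h1 h2
  · rw [Finset.mem_powerset] at hf
    refine ⟨(f.toLeft, f.toRight), ?_, Finset.toLeft_disjSum_toRight⟩
    rw [Finset.mem_product, Finset.mem_powerset, Finset.mem_powerset]
    constructor
    · intro v hv
      simpa using hf (Finset.mem_toLeft.1 hv)
    · intro v hv
      simpa using hf (Finset.mem_toRight.1 hv)
  · rw [Algebra.TensorProduct.tmul_mul_tmul, ← RForest.toCCK_add, ← RForest.toCCK_add,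
      RForest.toCCK_eq K (F.cont_add G e.1 e.2), RForest.part_add]

theorem RForest.coprod_edgeless (D V : Type*) [DecidableEq V] [Fintype V] :
    (RForest.edgeless D V).coprod K = 1 := by
  have h0 : (RForest.edgeless D V).edges = ∅ := by
    simp [RForest.edges, RForest.edgeless]
  have hp : (RForest.edgeless D V).part ∅ = RForest.edgeless D V := by
    ext1; funext v; simp [RForest.part, RForest.edgeless]
  have hc : (RForest.edgeless D V).cont ∅ = RForest.edgeless D _ := by
    ext1; funext v; simp [RForest.cont, RForest.edgeless]
  have h1 : ((RForest.edgeless D V).part ∅).toCCK K = 1 := by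
    rw [hp, RForest.toCCK, RForest.rcls_edgeless, map_one]
  have h2 : ((RForest.edgeless D V).cont ∅).toCCK K = 1 := by
    rw [hc, RForest.toCCK, RForest.rcls_edgeless, map_one]
  rw [RForest.coprod, h0, Finset.powerset_empty, Finset.sum_singleton, h1, h2]
  rfl

/-- The contraction coproduct on isomorphism classes of forests. -/
noncomputable def FClass.coprod (D : Type*) : FClass D →* CCK K D ⊗[K] CCK K D where
  toFun := Quotient.lift (fun F => F.2.coprod K) fun _ _ h => RForest.coprod_eq K h
  map_one' := (RForest.coprod_eq K ((RForest.empty D).isom_relabel _)).symm.trans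
    (RForest.coprod_edgeless K D (Fin 0))
  map_mul' a b := by
    induction a using Quotient.inductionOn with | _ F
    induction b using Quotient.inductionOn with | _ G
    exact (RForest.coprod_eq K ((F.2.add G.2).isom_relabel _)).symm.trans
      (RForest.coprod_add K F.2 G.2)

theorem FClass.coprod_cls (F : RForest D V) : FClass.coprod K D F.cls = F.coprod K :=
  (RForest.coprod_eq K (F.isom_relabel (Fintype.equivFin V))).symm

/-- The counit on isomorphism classes of forests: `1` if there is no edge, and `0` otherwise. -/
noncomputable def FClass.counit (D : Type*) : FClass D →* K where
  toFun := Quotient.lift (fun F => if F.2.edges = ∅ then 1 else 0) fun _ _ h => by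
    obtain ⟨σ, hσ⟩ := h
    simp only [hσ.edges, Finset.map_eq_empty]
  map_one' := by
    refine if_pos ?_
    change Finset.univ.filter _ = ∅
    rw [Finset.filter_eq_empty_iff]
    intro v
    simp [RForest.relabel, RForest.empty, RForest.edgeless]
  map_mul' a b := by
    induction a using Quotient.inductionOn with | _ F
    induction b using Quotient.inductionOn with | _ G
    have h := ((F.2.add G.2).isom_relabel (Fintype.equivFin _))
    obtain ⟨σ, hσ⟩ := h
    change (if ((F.2.add G.2).relabel (Fintype.equivFin _)).edges = ∅ then (1 : K) else 0) =
      (if F.2.edges = ∅ then 1 else 0) * (if G.2.edges = ∅ then 1 else 0)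
    rw [hσ.edges]
    simp only [Finset.map_eq_empty, RForest.edges_add, Finset.disjSum_eq_empty]
    by_cases h1 : F.2.edges = ∅ <;> by_cases h2 : G.2.edges = ∅ <;> simp [h1, h2]

theorem FClass.counit_cls (F : RForest D V) :
    FClass.counit K D F.cls = if F.edges = ∅ then 1 else 0 := by
  obtain ⟨σ, hσ⟩ := F.isom_relabel (Fintype.equivFin V)
  change (if (F.relabel (Fintype.equivFin V)).edges = ∅ then (1 : K) else 0) = _
  rw [hσ.edges]
  simp only [Finset.map_eq_empty]

theorem dotCon_le {M : Type*} [Monoid M] (f : FClass D →* M) (h : f (RForest.dot D).cls = 1) :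
    dotCon D ≤ Con.ker f := by
  refine Con.conGen_le.2 ?_
  rintro _ _ ⟨rfl, rfl⟩
  simp [Con.ker_rel, h]

/-- The contraction coproduct on forests, where the tree with one vertex is the unit. -/
noncomputable def RClass.coprod (D : Type*) : RClass D →* CCK K D ⊗[K] CCK K D :=
  (dotCon D).lift (FClass.coprod K D) (dotCon_le _ (by
    rw [FClass.coprod_cls]
    exact RForest.coprod_edgeless K D Unit))

/-- The counit on forests, where the tree with one vertex is the unit. -/
noncomputable def RClass.counit (D : Type*) : RClass D →* K :=
  (dotCon D).lift (FClass.counit K D) (dotCon_le _ (by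
    rw [FClass.counit_cls]
    exact if_pos (by simp [RForest.edges, RForest.dot, RForest.edgeless])))

/-- The contraction coproduct and the counit of `CCK K D`. -/
noncomputable instance (D : Type*) : CoalgebraStruct K (CCK K D) where
  comul := (MonoidAlgebra.lift K (CCK K D ⊗[K] CCK K D) (RClass D) (RClass.coprod K D)).toLinearMap
  counit := (MonoidAlgebra.lift K K (RClass D) (RClass.counit K D)).toLinearMap

theorem CCK.comul_toCCK (F : RForest D V) :
    CoalgebraStruct.comul (R := K) (F.toCCK K) = F.coprod K :=
  (MonoidAlgebra.lift_of (R := K) (RClass.coprod K D) F.rcls).trans (FClass.coprod_cls K F)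

theorem CCK.counit_toCCK (F : RForest D V) :
    CoalgebraStruct.counit (R := K) (F.toCCK K) = if F.edges = ∅ then 1 else 0 :=
  (MonoidAlgebra.lift_of (R := K) (RClass.counit K D) F.rcls).trans (FClass.counit_cls K F)

end CCK

namespace RForest

section NTree

variable {D V : Type*}

/-- The subtree of `F` with root `r`, where `r` is a root of `F`. -/
def treeAt (F : RForest D V) (r : V) : RForest D {v : V // F.rootOf v = r} where
  parent v :=
    match h : F.parent v.1 with
    | none => none
    | some (w, d) => some (⟨w, (F.rootOf_of_some h).symm.trans v.2⟩, d)
  wf := by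
    refine Subrelation.wf ?_ (InvImage.wf Subtype.val F.wf)
    rintro w v ⟨d, h⟩
    split at h
    · simp at h
    · rename_i w' d' h'
      simp only [Option.some.injEq, Prod.mk.injEq] at h
      obtain ⟨rfl, rfl⟩ := h
      exact ⟨_, h'⟩

theorem treeAt_none (F : RForest D V) {r : V} {v : {v : V // F.rootOf v = r}}
    (h : F.parent v.1 = none) : (F.treeAt r).parent v = none := by
  simp only [treeAt]
  split
  · rfl
  · simp_all

theorem treeAt_some (F : RForest D V) {r : V} {v : {v : V // F.rootOf v = r}} {w : V} {d : D}
    (h : F.parent v.1 = some (w, d)) :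
    (F.treeAt r).parent v = some (⟨w, (F.rootOf_of_some h).symm.trans v.2⟩, d) := by
  simp only [treeAt]
  split
  · simp_all
  · rename_i w' d' h'
    rw [h] at h'
    cases h'
    rfl

theorem isTree_treeAt (F : RForest D V) (r : V) (hr : F.parent r = none) :
    (F.treeAt r).IsTree := by
  refine ⟨⟨r, F.rootOf_of_none hr⟩, F.treeAt_none hr, fun v hv => ?_⟩
  rcases h : F.parent v.1 with _ | ⟨w, d⟩
  · exact Subtype.ext ((F.rootOf_of_none h).symm.trans v.2)
  · have hv' : (F.treeAt r).parent v = none := hv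
    rw [F.treeAt_some h] at hv'
    simp at hv'

end NTree

end RForest

/-- The nonempty trees: the classes of rooted trees with at least one edge, whose edges are
decorated by `D`. -/
def NTree (D : Type*) : Type _ :=
  {c : RClass D // ∃ (n : ℕ) (T : RForest D (Fin n)), T.IsTree ∧ T.edges.Nonempty ∧ T.rcls = c}

namespace RForest

variable {D V : Type*} [Fintype V]

theorem exists_tree (F : RForest D V) {v₀ : V} (h₀ : v₀ ∈ F.edges)
    (h : ∀ v ∈ F.edges, F.rootOf v = F.rootOf v₀) :
    ∃ (n : ℕ) (T : RForest D (Fin n)), T.IsTree ∧ T.edges.Nonempty ∧ T.rcls = F.rcls := by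
  classical
  set r := F.rootOf v₀ with hr
  let T := F.treeAt r
  have hT : T.IsTree := F.isTree_treeAt r (F.parent_rootOf v₀)
  obtain ⟨σ, hσ⟩ := T.isom_relabel (Fintype.equivFin _)
  refine ⟨_, T.relabel (Fintype.equivFin _), ?_, ?_, ?_⟩
  · obtain ⟨x, hx, hu⟩ := hT
    refine ⟨σ x, ?_, fun y hy => ?_⟩
    · change (T.relabel _).parent (σ x) = none
      rw [hσ x, hx]
      rfl
    · obtain ⟨z, rfl⟩ := σ.surjective y
      have hy' : (T.relabel _).parent (σ z) = none := hy
      rw [hσ z, Option.map_eq_none_iff] at hy'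
      rw [hu z hy']
  · rw [hσ.edges, Finset.map_nonempty]
    refine ⟨⟨v₀, rfl⟩, ?_⟩
    rw [mem_edges] at h₀ ⊢
    obtain ⟨⟨w, d⟩, hw⟩ := Option.isSome_iff_exists.1 h₀
    rw [F.treeAt_some (v := ⟨v₀, hr.symm⟩) hw]
    rfl
  · rw [← rcls_eq (T.isom_relabel _)]
    have key : (T.add (edgeless D {v : V // ¬ F.rootOf v = r})).Isom F := by
      refine ⟨Equiv.sumCompl _, ?_⟩
      rintro (v | v)
      · rcases hv : F.parent v.1 with _ | ⟨w, d⟩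
        · have := F.treeAt_none hv
          simp [add, T, this, hv]
        · have := F.treeAt_some hv
          simp [add, T, this, hv]
      · have : F.parent v.1 = none := by
          by_contra hc
          exact v.2 (h v.1 (mem_edges.2 (Option.isSome_iff_ne_none.2 hc)))
        simp [add, edgeless, this]
    rw [← rcls_eq key, rcls_add, rcls_edgeless, mul_one]

end RForest

namespace RForest

variable {D V : Type*}

theorem rootOf_eq_of_reachable (F : RForest D V) {v w : V} (h : F.graph.Reachable v w) :
    F.rootOf v = F.rootOf w := by
  obtain ⟨p⟩ := h
  induction p with
  | nil => rfl
  | cons h _ ih =>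
    rw [← ih]
    rcases h with ⟨d, h⟩ | ⟨d, h⟩
    · exact F.rootOf_of_some h
    · exact (F.rootOf_of_some h).symm

variable [DecidableEq V]

theorem rootOf_part (F : RForest D V) (e : Finset V) (v : V) :
    F.rootOf ((F.part e).rootOf v) = F.rootOf v := by
  induction v using (F.part e).induct with
  | h0 v h => rw [(F.part e).rootOf_of_none h]
  | h1 v w d h ih =>
    rw [(F.part e).rootOf_of_some h, ih]
    by_cases hv : v ∈ e
    · exact (F.rootOf_of_some (d := d) (by simpa [part, hv] using h)).symm
    · simp [part, hv] at h

theorem rootOf_cont (F : RForest D V) (e : Finset V) (v : F.ContVertex e) :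
    ((F.cont e).rootOf v).1 = F.rootOf v.1 := by
  induction v using (F.cont e).induct with
  | h0 v h =>
    rw [(F.cont e).rootOf_of_none h, F.rootOf_of_none]
    simpa [cont] using h
  | h1 v w d h ih =>
    rw [(F.cont e).rootOf_of_some h, ih]
    simp only [cont, Option.map_eq_some_iff, Prod.exists, Prod.map_apply, Prod.mk.injEq] at h
    obtain ⟨x, d', h, rfl, -⟩ := h
    rw [F.rootOf_of_some h]
    exact F.rootOf_part e x

variable [Fintype V]

theorem mem_edges_cont (F : RForest D V) (e : Finset V) (v : F.ContVertex e) :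
    v ∈ (F.cont e).edges ↔ v.1 ∈ F.edges \ e := by
  have hv := v.2
  simp only [part, ite_eq_right_iff] at hv
  rw [mem_edges, Finset.mem_sdiff, mem_edges]
  simp only [cont, Option.isSome_map]
  refine ⟨fun h => ⟨h, fun h' => ?_⟩, fun h => h.1⟩
  rw [hv h'] at h
  simp at h

/-- The block `e_i` of a generalized partition of `F` gives the nonempty tree `Cont_ē(F)`, where `ē`
is the complement of `e_i` in the set of edges of `F`. -/
noncomputable def blockTree (F : RForest D V) {k : ℕ} {p : Fin k → Finset V}
    (hp : F.IsGenPartition p) (i : Fin k) : NTree D :=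
  ⟨(F.cont (F.edges \ p i)).rcls, by
    have hi : p i ⊆ F.edges := by
      rw [← hp.union]
      exact Finset.subset_biUnion_of_mem p (Finset.mem_univ i)
    have hd : F.edges \ (F.edges \ p i) = p i := Finset.sdiff_sdiff_eq_self hi
    obtain ⟨u, hu⟩ := hp.nonempty i
    have hu' : (F.part (F.edges \ p i)).parent u = none := by simp [part, hu]
    refine (F.cont (F.edges \ p i)).exists_tree (v₀ := ⟨u, hu'⟩) ?_ fun v hv => ?_
    · rw [mem_edges_cont, hd]
      exact hu
    · rw [mem_edges_cont, hd] at hv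
      apply Subtype.ext
      rw [rootOf_cont, rootOf_cont]
      exact F.rootOf_eq_of_reachable (hp.component i v.1 hv u hu)⟩

end RForest

noncomputable instance {D V : Type*} [Fintype V] [DecidableEq V] (F : RForest D V) (k : ℕ) :
    Fintype {p : Fin k → Finset V // F.IsGenPartition p} :=
  Fintype.ofFinite _

/-- The inclusion of the space spanned by the nonempty trees into `CCK K D`. -/
noncomputable def CCK.incl (K D : Type*) [Field K] : (NTree D →₀ K) →ₗ[K] CCK K D :=
  Finsupp.linearCombination K fun t => CCK.of K D t.1

/-- The space spanned by the words with letters in `D`, that is, the tensor module over the vector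
space with basis `D`. -/
def Sh (K D : Type*) [Field K] : Type _ := List D →₀ K

namespace Sh

variable (K : Type*) [Field K] {D : Type*}

noncomputable instance : AddCommGroup (Sh K D) := inferInstanceAs (AddCommGroup (List D →₀ K))

noncomputable instance : Module K (Sh K D) := inferInstanceAs (Module K (List D →₀ K))

/-- A word, as a basis vector. -/
noncomputable def word (w : List D) : Sh K D := Finsupp.single w 1

/-- The linear extension to `Sh K D` of a map defined on words. -/
noncomputable def extend {M : Type*} [AddCommGroup M] [Module K M] (f : List D → M) :
    Sh K D →ₗ[K] M :=
  Finsupp.linearCombination K f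

@[simp] theorem extend_word {M : Type*} [AddCommGroup M] [Module K M] (f : List D → M)
    (w : List D) : extend K f (word K w) = f w :=
  (Finsupp.linearCombination_single K 1 w).trans (one_smul K (f w))

theorem hom_ext {M : Type*} [AddCommGroup M] [Module K M] {f g : Sh K D →ₗ[K] M}
    (h : ∀ w, f (word K w) = g (word K w)) : f = g :=
  Finsupp.lhom_ext' fun w => LinearMap.ext_ring (h w)

/-- Put the letter `d` in front of each word. -/
noncomputable def cons (d : D) : Sh K D →ₗ[K] Sh K D := extend K fun w => word K (d :: w)

@[simp] theorem cons_word (d : D) (w : List D) : cons K d (word K w) = word K (d :: w) := by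
  simp [cons]

/-- The sum of all the shuffles of two words. -/
noncomputable def shuffle : List D → List D → Sh K D
  | [], v => word K v
  | a :: u, [] => word K (a :: u)
  | a :: u, b :: v => cons K a (shuffle u (b :: v)) + cons K b (shuffle (a :: u) v)
termination_by u v => u.length + v.length

/-- The shuffle product as a bilinear map. -/
noncomputable def mulₗ : Sh K D →ₗ[K] Sh K D →ₗ[K] Sh K D :=
  extend K fun u => extend K fun v => shuffle K u v

theorem mulₗ_word (u v : List D) : mulₗ K (word K u) (word K v) = shuffle K u v := by
  simp [mulₗ]

theorem shuffle_nil (u : List D) : shuffle K u [] = word K u := by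
  cases u <;> simp [shuffle]

theorem shuffle_comm : ∀ u v : List D, shuffle K u v = shuffle K v u
  | [], v => by rw [shuffle_nil, shuffle]
  | a :: u, [] => by rw [shuffle_nil, shuffle]
  | a :: u, b :: v => by
    rw [shuffle, shuffle, shuffle_comm u (b :: v), shuffle_comm (a :: u) v, add_comm]
termination_by u v => u.length + v.length

theorem mulₗ_comm (x y : Sh K D) : mulₗ K x y = mulₗ K y x := by
  have : mulₗ K (D := D) = (mulₗ K).flip :=
    hom_ext K fun u => hom_ext K fun v => by
      rw [LinearMap.flip_apply, mulₗ_word, mulₗ_word, shuffle_comm]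
  exact LinearMap.congr_fun₂ this x y

theorem one_mulₗ (x : Sh K D) : mulₗ K (word K []) x = x := by
  have : mulₗ K (word K ([] : List D)) = LinearMap.id :=
    hom_ext K fun u => by simp [mulₗ_word, shuffle]
  exact LinearMap.congr_fun this x

theorem cons_mulₗ_cons (a b : D) (x y : Sh K D) :
    mulₗ K (cons K a x) (cons K b y) =
      cons K a (mulₗ K x (cons K b y)) + cons K b (mulₗ K (cons K a x) y) := by
  have : (mulₗ K).compl₁₂ (cons K a) (cons K b) =
      ((mulₗ K).compl₂ (cons K b)).compr₂ (cons K a) +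
        ((mulₗ K).comp (cons K a)).compr₂ (cons K b) :=
    hom_ext K fun u => hom_ext K fun v => by simp [mulₗ_word, shuffle]
  exact LinearMap.congr_fun₂ this x y

theorem mulₗ_assoc_word : ∀ u v w : List D,
    mulₗ K (mulₗ K (word K u) (word K v)) (word K w) =
      mulₗ K (word K u) (mulₗ K (word K v) (word K w))
  | [], v, w => by rw [one_mulₗ, one_mulₗ]
  | a :: u, [], w => by rw [one_mulₗ, mulₗ_comm K _ (word K []), one_mulₗ]
  | a :: u, b :: v, [] => by
    rw [mulₗ_comm K _ (word K []), one_mulₗ, mulₗ_comm K _ (word K []), one_mulₗ]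
  | a :: u, b :: v, c :: w => by
    have h1 := mulₗ_assoc_word u (b :: v) (c :: w)
    have h2 := mulₗ_assoc_word (a :: u) v (c :: w)
    have h3 := mulₗ_assoc_word (a :: u) (b :: v) w
    simp only [← cons_word] at h1 h2 h3 ⊢
    simp only [cons_mulₗ_cons, map_add, LinearMap.add_apply] at h1 h2 h3 ⊢
    have h4 := congrArg (cons K c) h3
    simp only [map_add] at h4
    rw [h1, h2, map_add, ← h4]
    abel
termination_by u v w => u.length + v.length + w.length

theorem mulₗ_assoc (x y z : Sh K D) : mulₗ K (mulₗ K x y) z = mulₗ K x (mulₗ K y z) := by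
  have : (mulₗ K (D := D)).compr₂ (mulₗ K) =
      (LinearMap.lcomp K _ (mulₗ K)).comp ((LinearMap.llcomp K _ _ _).comp (mulₗ K)) :=
    hom_ext K fun u => hom_ext K fun v => hom_ext K fun w => mulₗ_assoc_word K u v w
  exact LinearMap.congr_fun (LinearMap.congr_fun₂ this x y) z

/-- The product of `Sh K D` is the shuffle product. -/
noncomputable instance : CommRing (Sh K D) where
  __ := (inferInstance : AddCommGroup (Sh K D))
  mul x y := mulₗ K x y
  one := word K []
  left_distrib x y z := map_add (mulₗ K x) y z
  right_distrib x y z := LinearMap.map_add₂ (mulₗ K) x y z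
  zero_mul x := LinearMap.map_zero₂ (mulₗ K) x
  mul_zero x := map_zero (mulₗ K x)
  mul_assoc := mulₗ_assoc K
  one_mul := one_mulₗ K
  mul_one x := (mulₗ_comm K x _).trans (one_mulₗ K x)
  mul_comm := mulₗ_comm K

noncomputable instance : Algebra K (Sh K D) :=
  Algebra.ofModule (fun c x y => LinearMap.map_smul₂ (mulₗ K) c x y)
    fun c x y => map_smul (mulₗ K x) c y

/-- The coproduct is the deconcatenation, and the counit is the coefficient of the empty word. -/
noncomputable instance : CoalgebraStruct K (Sh K D) where
  comul := extend K fun w =>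
    ∑ i ∈ Finset.range (w.length + 1), word K (w.take i) ⊗ₜ[K] word K (w.drop i)
  counit := extend K fun w => if w = [] then 1 else 0

/-- The projection of `Sh K D` onto the space spanned by `D`, that is, by the words with one
letter. -/
noncomputable def proj : Sh K D →ₗ[K] (D →₀ K) :=
  extend K fun w =>
    match w with
    | [d] => Finsupp.single d 1
    | _ => 0

/-- The word `x_1 ⋯ x_k` whose letters are vectors of the space spanned by `D`; it depends on each
letter linearly. -/
noncomputable def concat : List (D →₀ K) → Sh K D
  | [] => word K []
  | x :: l => x.sum fun d c => c • cons K d (concat l)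

end Sh

/-- `Φ` makes the diagram commute: `π ∘ Φ ∘ i = φ` on the space spanned by the nonempty trees. -/
def Lifts {K D : Type*} [Field K] (φ : (NTree D →₀ K) →ₗ[K] (D →₀ K)) (Φ : CCK K D →ₐc[K] Sh K D) :
    Prop :=
  ∀ x : NTree D →₀ K, Sh.proj K (Φ (CCK.incl K D x)) = φ x

end ContractionForest

/-! The deconcatenation coalgebra is cofree enough that a vector is known from its counit and its
one-letter projections: `s = ε(s) + (π · id)(Δ s)`, where the first letter is split off and put back
(`Sh.eq_counit_add_consL`). Let `letter φ` be `φ` on nonempty trees and `0` on all other classes.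
For a lift `Φ`, one has `π ∘ Φ = letter φ` on every class (`Lifts.proj_of`): a class that is neither
`1` nor a nonempty tree is a product of two nontrivial classes, and `π` kills shuffle products of
vectors without constant term. Hence `Φ(F) = ε(F) + ∑_e letter(Part_e F) · Φ(Cont_e F)`. Since
`letter φ` vanishes on `1`, the term `e = ∅` drops out, and the other contractions have fewer edges.
The recursion therefore has exactly one solution, which gives uniqueness.

For existence, the solution of the recursion respects the coproducts because the contraction
coproduct is coassociative (`comul_solution`). It respects the products because `letter φ` kills
nontrivial products, so that the recursion for `F G` becomes the recursion that defines the shuffle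
product (`solution_mul`).

The formula comes from splitting off the last letter instead: `Φ(F) = ε(F) + ∑_g Φ(Part_g F) ·
letter(Cont_g F)`. The sum over generalized partitions obeys the same recursion, the last block
being `E(F) \ g`. The reason is a reformulation of the path condition (`isGenPartition_iff`): each
block `e_i` lies in one component of the forest formed by `e_1 ∪ ⋯ ∪ e_i`. So deleting the last
block leaves a generalized partition of `Part_g F`, and the remaining blocks give the same
contracted trees in `F` as in `Part_g F` (`rcls_cont_part`). -/

namespace ContractionForest

/-! ### Splitting off the first or the last letter in the shuffle algebra. -/

namespace Sh

variable {K : Type*} [Field K] {D : Type*}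

open CoalgebraStruct TensorProduct

theorem word_nil : word K ([] : List D) = 1 := rfl

@[simp] theorem comul_word (w : List D) : comul (R := K) (word K w) =
    ∑ i ∈ Finset.range (w.length + 1), word K (w.take i) ⊗ₜ[K] word K (w.drop i) :=
  extend_word K _ w

@[simp] theorem counit_word (w : List D) :
    counit (R := K) (word K w) = if w = [] then 1 else 0 :=
  extend_word K _ w

theorem comul_one : comul (R := K) (1 : Sh K D) = 1 ⊗ₜ[K] 1 := by
  rw [← word_nil, comul_word]
  simp

theorem counit_one : counit (R := K) (1 : Sh K D) = 1 := by
  rw [← word_nil, counit_word, if_pos rfl]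

@[simp] theorem proj_word (w : List D) :
    proj K (word K w) = match w with
      | [d] => Finsupp.single d 1
      | _ => 0 :=
  extend_word K _ w

theorem proj_one : proj K (1 : Sh K D) = 0 := by
  rw [← word_nil, proj_word]

/-- Put the letter `d` after each word. -/
noncomputable def snoc (K : Type*) [Field K] {D : Type*} (d : D) : Sh K D →ₗ[K] Sh K D :=
  extend K fun w => word K (w ++ [d])

@[simp] theorem snoc_word (d : D) (w : List D) : snoc K d (word K w) = word K (w ++ [d]) :=
  extend_word K _ w

/-- Put a letter, which is a vector of the space spanned by `D`, in front of each word. -/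
noncomputable def consL : (D →₀ K) →ₗ[K] Sh K D →ₗ[K] Sh K D :=
  Finsupp.linearCombination K (cons K)

/-- Put a letter, which is a vector of the space spanned by `D`, after each word. -/
noncomputable def snocL : (D →₀ K) →ₗ[K] Sh K D →ₗ[K] Sh K D :=
  Finsupp.linearCombination K (snoc K)

@[simp] theorem consL_single (d : D) : consL (Finsupp.single d (1 : K)) = cons K d := by
  simp [consL]

@[simp] theorem snocL_single (d : D) : snocL (Finsupp.single d (1 : K)) = snoc K d := by
  simp [snocL]

theorem concat_cons (x : D →₀ K) (l : List (D →₀ K)) :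
    concat K (x :: l) = consL x (concat K l) := by
  rw [concat, consL, Finsupp.linearCombination_apply, Finsupp.sum, Finsupp.sum,
    LinearMap.sum_apply]
  rfl

theorem consL_snocL (x y : D →₀ K) (s : Sh K D) :
    consL x (snocL y s) = snocL y (consL x s) := by
  have h : (LinearMap.llcomp K (Sh K D) (Sh K D) (Sh K D)).compl₁₂ consL snocL =
      ((LinearMap.llcomp K (Sh K D) (Sh K D) (Sh K D)).compl₁₂ snocL consL).flip := by
    refine Finsupp.lhom_ext' fun d => LinearMap.ext_ring <| Finsupp.lhom_ext' fun d' =>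
      LinearMap.ext_ring <| hom_ext K fun w => ?_
    simp
  exact LinearMap.congr_fun (LinearMap.congr_fun₂ h x y) s

/-- `concat` is built from the front, whereas generalized partitions are peeled from the back; this
links the two. -/
theorem concat_append_singleton (l : List (D →₀ K)) (x : D →₀ K) :
    concat K (l ++ [x]) = snocL x (concat K l) := by
  induction l with
  | nil =>
    rw [List.nil_append, concat_cons, concat, word_nil]
    have h : (consL (K := K) (D := D)).flip 1 = snocL.flip 1 := by
      refine Finsupp.lhom_ext' fun d => LinearMap.ext_ring ?_
      simp [← word_nil]
    exact LinearMap.congr_fun h x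
  | cons y l ih => rw [List.cons_append, concat_cons, concat_cons, ih, consL_snocL]

theorem consL_mul_consL (x y : D →₀ K) (s t : Sh K D) :
    consL x s * consL y t = consL x (s * consL y t) + consL y (consL x s * t) := by
  induction x using Finsupp.induction_linear with
  | zero => simp
  | add x x' hx hx' => simp only [map_add, LinearMap.add_apply, add_mul, hx, hx']; abel
  | single d c =>
    induction y using Finsupp.induction_linear with
    | zero => simp
    | add y y' hy hy' => simp only [map_add, LinearMap.add_apply, mul_add, hy, hy']; abel
    | single d' c' =>
      have h : ∀ (d : D) (c : K), Finsupp.single d c = c • Finsupp.single d 1 := by simp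
      rw [h d, h d']
      simp only [map_smul, LinearMap.smul_apply, smul_mul_assoc, mul_smul_comm, consL_single]
      rw [smul_comm c c']
      rw [show cons K d s * cons K d' t = cons K d (s * cons K d' t) + cons K d' (cons K d s * t)
        from cons_mulₗ_cons K d d' s t, smul_add, smul_add]

/-- The cut before the new letter gives the first term; every other cut is a cut of the old word. -/
theorem comul_consL (x : D →₀ K) (s : Sh K D) :
    comul (R := K) (consL x s) =
      1 ⊗ₜ[K] consL x s + TensorProduct.map (consL x) LinearMap.id (comul (R := K) s) := by
  have h : (consL (K := K) (D := D)).compr₂ comul = consL.compr₂ (TensorProduct.mk K _ _ 1) +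
      ((LinearMap.rTensorHom _).comp consL).compl₂ comul := by
    refine Finsupp.lhom_ext' fun d => LinearMap.ext_ring <| hom_ext K fun w => ?_
    simp only [LinearMap.coe_comp, Function.comp_apply, Finsupp.lsingle_apply,
      LinearMap.compr₂_apply, consL_single, cons_word, comul_word, LinearMap.add_apply,
      LinearMap.compl₂_apply, LinearMap.coe_rTensorHom, map_sum, LinearMap.rTensor_tmul,
      TensorProduct.mk_apply, List.length_cons]
    rw [Finset.sum_range_succ', add_comm]
    simp [word_nil]
  exact LinearMap.congr_fun₂ h x s

theorem comul_snoc (d : D) (s : Sh K D) :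
    comul (R := K) (snoc K d s) =
      snoc K d s ⊗ₜ[K] 1 + TensorProduct.map LinearMap.id (snoc K d) (comul (R := K) s) := by
  have h : comul ∘ₗ snoc K d = ((TensorProduct.mk K _ _).flip 1) ∘ₗ snoc K d +
      TensorProduct.map LinearMap.id (snoc K d) ∘ₗ comul (R := K) := by
    refine hom_ext K fun w => ?_
    simp only [LinearMap.coe_comp, Function.comp_apply, snoc_word, comul_word, LinearMap.add_apply,
      LinearMap.flip_apply, TensorProduct.mk_apply, map_sum, TensorProduct.map_tmul,
      LinearMap.id_apply]
    rw [List.length_append, List.length_singleton, Finset.sum_range_succ, add_comm]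
    congr 1
    · rw [List.take_of_length_le (by simp), List.drop_of_length_le (by simp), word_nil]
    · refine Finset.sum_congr rfl fun i hi => ?_
      have hi' : i ≤ w.length := by simpa [Nat.lt_succ_iff] using hi
      rw [List.take_append_of_le_length hi', List.drop_append_of_le_length hi']
  exact LinearMap.congr_fun h s

theorem counit_consL (x : D →₀ K) (s : Sh K D) : counit (R := K) (consL x s) = 0 := by
  have h : (consL (K := K) (D := D)).compr₂ counit = 0 := by
    refine Finsupp.lhom_ext' fun d => LinearMap.ext_ring <| hom_ext K fun w => ?_
    simp
  exact LinearMap.congr_fun₂ h x s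

theorem proj_consL (x : D →₀ K) (s : Sh K D) :
    proj K (consL x s) = counit (R := K) s • x := by
  have h : (consL (K := K) (D := D)).compr₂ (proj K) =
      (LinearMap.lsmul K (D →₀ K)).flip.compl₂ counit := by
    refine Finsupp.lhom_ext' fun d => LinearMap.ext_ring <| hom_ext K fun w => ?_
    rcases w with _ | ⟨a, w⟩ <;> simp
  exact LinearMap.congr_fun₂ h x s

theorem proj_snoc (d : D) (s : Sh K D) :
    proj K (snoc K d s) = counit (R := K) s • Finsupp.single d 1 := by
  have h : proj K ∘ₗ snoc K d =
      (LinearMap.toSpanSingleton K (D →₀ K) (Finsupp.single d 1)) ∘ₗ counit := by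
    refine hom_ext K fun w => ?_
    rcases w with _ | ⟨a, w⟩
    · simp
    · rcases w with _ | ⟨b, w⟩ <;> simp
  exact LinearMap.congr_fun h s

/-- A shuffle of two nonempty words has at least two letters, so the projection is a derivation with
respect to the counit. -/
theorem proj_mul (x y : Sh K D) :
    proj K (x * y) = counit (R := K) y • proj K x + counit (R := K) x • proj K y := by
  have hw : ∀ u v : List D, proj K (word K u * word K v) =
      counit (R := K) (word K v) • proj K (word K u) +
        counit (R := K) (word K u) • proj K (word K v) := by
    intro u v
    rcases u with _ | ⟨a, u⟩
    · rw [word_nil, one_mul, proj_one, counit_one]; simp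
    rcases v with _ | ⟨b, v⟩
    · rw [word_nil, mul_one, proj_one, counit_one]; simp
    have h0 : ∀ (a : D) u, word K (a :: u) = consL (Finsupp.single a 1) (word K u) := by simp
    have hc : ∀ (u v : List D) (a : D), counit (R := K) (word K u * word K (a :: v)) = 0 := by
      intro u v a
      rcases u with _ | ⟨b, u⟩
      · rw [word_nil, one_mul]; simp
      · rw [h0, h0, consL_mul_consL, map_add, counit_consL, counit_consL, add_zero]
    rw [h0 a u, h0 b v, consL_mul_consL, map_add, proj_consL, proj_consL, ← h0, ← h0, hc,
      mul_comm, hc]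
    simp
  have h : (mulₗ K (D := D)).compr₂ (proj K) =
      ((LinearMap.lsmul K (D →₀ K)).compl₁₂ counit (proj K)).flip +
        (LinearMap.lsmul K (D →₀ K)).compl₁₂ counit (proj K) :=
    hom_ext K fun u => hom_ext K fun v => hw u v
  exact LinearMap.congr_fun₂ h x y

/-- `Sh K D` carries only a `CoalgebraStruct`, so the two counit laws have to be checked on words.
-/
theorem rTensor_counit_comul (s : Sh K D) :
    (counit (R := K) (A := Sh K D)).rTensor (Sh K D) (comul s) = (1 : K) ⊗ₜ s := by
  have h : (counit (R := K) (A := Sh K D)).rTensor (Sh K D) ∘ₗ comul =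
      TensorProduct.mk K K (Sh K D) 1 := by
    refine hom_ext K fun w => ?_
    rcases w with _ | ⟨a, w⟩
    · simp
    · have h0 : word K (a :: w) = consL (Finsupp.single a 1) (word K w) := by simp
      have h1 : counit ∘ₗ consL (Finsupp.single a (1 : K)) = 0 :=
        LinearMap.ext (counit_consL _)
      rw [LinearMap.comp_apply, h0, comul_consL, map_add, LinearMap.rTensor_tmul, counit_one,
        LinearMap.rTensor, ← LinearMap.comp_apply (TensorProduct.map _ _), ← TensorProduct.map_comp,
        h1]
      simp
  exact LinearMap.congr_fun h s

theorem lTensor_counit_comul (s : Sh K D) :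
    (counit (R := K) (A := Sh K D)).lTensor (Sh K D) (comul s) = s ⊗ₜ (1 : K) := by
  have h : (counit (R := K) (A := Sh K D)).lTensor (Sh K D) ∘ₗ comul =
      (TensorProduct.mk K (Sh K D) K).flip 1 := by
    refine hom_ext K fun w => ?_
    induction w using List.reverseRecOn with
    | nil => simp
    | append_singleton w a _ =>
      have h0 : word K (w ++ [a]) = snoc K a (word K w) := by simp
      have h1 : counit ∘ₗ snoc K a = 0 := hom_ext K fun w => by simp
      rw [LinearMap.comp_apply, h0, comul_snoc, map_add, LinearMap.lTensor_tmul, counit_one,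
        LinearMap.lTensor, ← LinearMap.comp_apply (TensorProduct.map _ _), ← TensorProduct.map_comp,
        h1]
      simp
  exact LinearMap.congr_fun h s

/-- A vector of `Sh K D` is recovered by splitting off the first letters. -/
theorem eq_counit_add_consL (s : Sh K D) :
    s = counit (R := K) s • 1 + TensorProduct.lift (consL.comp (proj K)) (comul s) := by
  have h : LinearMap.id = (LinearMap.toSpanSingleton K (Sh K D) 1) ∘ₗ counit +
      TensorProduct.lift (consL.comp (proj K)) ∘ₗ comul := by
    refine hom_ext K fun w => ?_
    rcases w with _ | ⟨a, w⟩
    · simp [← word_nil]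
    · have h0 : word K (a :: w) = consL (Finsupp.single a 1) (word K w) := by simp
      -- Among the cuts after the letter `a`, only the one directly after it leaves a one-letter
      -- left factor, so the projection acts as the counit on the rest of that factor. The cut
      -- before `a` is killed by `proj_one`.
      have h1 : TensorProduct.lift (consL.comp (proj K)) ∘ₗ
            TensorProduct.map (consL (Finsupp.single a (1 : K))) LinearMap.id =
          TensorProduct.lift ((LinearMap.lsmul K (Sh K D)).compl₂ (cons K a)) ∘ₗ
            counit.rTensor (Sh K D) := by
        refine TensorProduct.ext' fun x y => ?_
        simp [proj_consL, ← consL_single, -Finsupp.smul_single]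
      have h2 := LinearMap.congr_fun h1 (comul (word K w))
      simp only [LinearMap.comp_apply] at h2
      rw [h0]
      simp only [LinearMap.id_apply, LinearMap.add_apply, LinearMap.comp_apply, counit_consL,
        comul_consL, map_add, TensorProduct.lift.tmul, proj_one, h2, rTensor_counit_comul]
      simp
  exact LinearMap.congr_fun h s

/-- A vector of `Sh K D` is recovered by splitting off the last letters. -/
theorem eq_counit_add_snocL (s : Sh K D) :
    s = counit (R := K) s • 1 + TensorProduct.lift (snocL.comp (proj K)).flip (comul s) := by
  have h : LinearMap.id = (LinearMap.toSpanSingleton K (Sh K D) 1) ∘ₗ counit +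
      TensorProduct.lift (snocL.comp (proj K)).flip ∘ₗ comul := by
    refine hom_ext K fun w => ?_
    induction w using List.reverseRecOn with
    | nil => simp [← word_nil]
    | append_singleton w a _ =>
      have h0 : word K (w ++ [a]) = snoc K a (word K w) := by simp
      have h1 : TensorProduct.lift (snocL.comp (proj K)).flip ∘ₗ
            TensorProduct.map LinearMap.id (snoc K a) =
          TensorProduct.lift ((LinearMap.lsmul K (Sh K D)).compl₂ (snoc K a)).flip ∘ₗ
            counit.lTensor (Sh K D) := by
        refine TensorProduct.ext' fun x y => ?_
        simp [proj_snoc, -Finsupp.smul_single]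
      have h2 := LinearMap.congr_fun h1 (comul (word K w))
      simp only [LinearMap.comp_apply] at h2
      have h3 : counit (R := K) (snoc K a (word K w)) = 0 := by simp
      rw [h0]
      simp only [LinearMap.id_apply, LinearMap.add_apply, LinearMap.comp_apply, h3,
        comul_snoc, map_add, TensorProduct.lift.tmul, h2, lTensor_counit_comul]
      simp [proj_one]
  exact LinearMap.congr_fun h s

end Sh

/-! ### Invariants of classes: the numbers of edges and of nonempty trees. -/

theorem RClass.ind {D : Type*} {P : RClass D → Prop} (h : ∀ n (F : RForest D (Fin n)), P F.rcls)
    (c : RClass D) : P c := by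
  induction c using Con.induction_on with
  | _ c => exact FClass.ind' (P := fun c => P c) h c

theorem RForest.IsTree.rootOf_eq {D V : Type*} {F : RForest D V} (hF : F.IsTree) (v w : V) :
    F.rootOf v = F.rootOf w :=
  hF.unique (F.parent_rootOf v) (F.parent_rootOf w)

namespace RForest

section Invariants

variable {D V W : Type*} [Fintype V] [Fintype W]

open Classical in
/-- The roots of the connected components with at least one edge. -/
noncomputable def fullRoots (F : RForest D V) : Finset V := F.edges.image F.rootOf

theorem IsIso.fullRoots {F : RForest D V} {G : RForest D W} {σ : V ≃ W} (h : F.IsIso G σ) :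
    G.fullRoots = F.fullRoots.map σ.toEmbedding := by
  classical
  ext w
  simp only [RForest.fullRoots, h.edges, Finset.mem_image, Finset.mem_map, Equiv.coe_toEmbedding,
    exists_exists_and_eq_and, h.rootOf]

theorem fullRoots_eq_empty {F : RForest D V} : F.fullRoots = ∅ ↔ F.edges = ∅ := by
  classical
  exact Finset.image_eq_empty

theorem card_fullRoots_add (F : RForest D V) (G : RForest D W) :
    (F.add G).fullRoots.card = F.fullRoots.card + G.fullRoots.card := by
  rw [← Finset.card_disjSum]
  congr 1
  ext x
  rcases x with v | v <;> simp [fullRoots, edges_add, rootOf_add_inl, rootOf_add_inr]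

/-- The number of edges, and the number of connected components with at least one edge. -/
noncomputable def size (F : RForest D V) : Multiplicative (ℕ × ℕ) :=
  .ofAdd (F.edges.card, F.fullRoots.card)

theorem size_eq {F : RForest D V} {G : RForest D W} (h : F.Isom G) : F.size = G.size := by
  obtain ⟨σ, hσ⟩ := h
  simp only [size, hσ.edges, hσ.fullRoots, Finset.card_map]

theorem size_add (F : RForest D V) (G : RForest D W) : (F.add G).size = F.size * G.size := by
  simp only [size, edges_add, card_fullRoots_add, Finset.card_disjSum]
  rfl

theorem size_edgeless (D V : Type*) [Fintype V] : (edgeless D V).size = 1 := by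
  have h0 : (edgeless D V).edges = ∅ := by simp [edges, edgeless]
  simp only [size, fullRoots, h0]
  rfl

end Invariants

end RForest

/-- The size of a class of forests. -/
noncomputable def RClass.size (D : Type*) : RClass D →* Multiplicative (ℕ × ℕ) :=
  (dotCon D).lift
    { toFun := Quotient.lift (fun F => F.2.size) fun _ _ h => RForest.size_eq h
      map_one' := (RForest.size_eq ((RForest.empty D).isom_relabel _)).symm.trans
        (RForest.size_edgeless D (Fin 0))
      map_mul' := fun a b => by
        induction a using Quotient.inductionOn with | _ F
        induction b using Quotient.inductionOn with | _ G
        exact (RForest.size_eq ((F.2.add G.2).isom_relabel _)).symm.trans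
          (RForest.size_add F.2 G.2) }
    -- The one-vertex tree has neither an edge nor a component with an edge, so both counts survive
    -- its identification with `1`.
    (dotCon_le _ ((RForest.size_eq ((RForest.dot D).isom_relabel _)).symm.trans
      (RForest.size_edgeless D Unit)))

theorem RClass.size_rcls {D V : Type*} [Fintype V] (F : RForest D V) :
    RClass.size D F.rcls = F.size :=
  (RForest.size_eq (F.isom_relabel (Fintype.equivFin V))).symm

/-- The number of edges of a class of forests. -/
noncomputable def RClass.numEdges {D : Type*} (c : RClass D) : ℕ := (RClass.size D c).toAdd.1

/-- The number of trees with at least one edge of a class of forests. -/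
noncomputable def RClass.numTrees {D : Type*} (c : RClass D) : ℕ := (RClass.size D c).toAdd.2

namespace RClass

variable {D : Type*}

theorem numEdges_mul (c d : RClass D) : (c * d).numEdges = c.numEdges + d.numEdges := by
  simp [numEdges]

theorem numTrees_mul (c d : RClass D) : (c * d).numTrees = c.numTrees + d.numTrees := by
  simp [numTrees]

variable {V : Type*} [Fintype V]

@[simp] theorem numEdges_rcls (F : RForest D V) : F.rcls.numEdges = F.edges.card := by
  simp [numEdges, size_rcls, RForest.size]

@[simp] theorem numTrees_rcls (F : RForest D V) : F.rcls.numTrees = F.fullRoots.card := by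
  simp [numTrees, size_rcls, RForest.size]

end RClass

namespace RForest

variable {D V : Type*} [Fintype V]

theorem rcls_eq_one (F : RForest D V) (h : F.edges = ∅) : F.rcls = 1 := by
  rw [← rcls_edgeless D V]
  congr 1
  ext1
  funext v
  have : v ∉ F.edges := by simp [h]
  simpa [mem_edges, edgeless] using this

theorem fullRoots_card_eq_one (F : RForest D V) :
    F.fullRoots.card = 1 ↔ ∃ v₀ ∈ F.edges, ∀ v ∈ F.edges, F.rootOf v = F.rootOf v₀ := by
  classical
  rw [Finset.card_eq_one]
  constructor
  · rintro ⟨r, hr⟩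
    have h1 : r ∈ F.fullRoots := by simp [hr]
    obtain ⟨v₀, h₀, rfl⟩ := Finset.mem_image.1 h1
    refine ⟨v₀, h₀, fun v hv => ?_⟩
    have := Finset.mem_image_of_mem F.rootOf hv
    exact Finset.mem_singleton.1 (hr ▸ this)
  · rintro ⟨v₀, h₀, h⟩
    refine ⟨F.rootOf v₀, ?_⟩
    ext r
    simp only [fullRoots, Finset.mem_image, Finset.mem_singleton]
    exact ⟨fun ⟨v, hv, hr⟩ => hr ▸ h v hv, fun hr => ⟨v₀, h₀, hr.symm⟩⟩

end RForest

/-- A class of forests is a nonempty tree iff it has exactly one tree with at least one edge. -/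
theorem RClass.exists_tree_iff {D : Type*} (c : RClass D) :
    (∃ (n : ℕ) (T : RForest D (Fin n)), T.IsTree ∧ T.edges.Nonempty ∧ T.rcls = c) ↔
      c.numTrees = 1 := by
  constructor
  · rintro ⟨n, T, hT, ⟨v, hv⟩, rfl⟩
    rw [numTrees_rcls, T.fullRoots_card_eq_one]
    exact ⟨v, hv, fun w _ => hT.rootOf_eq w v⟩
  · induction c using RClass.ind with | _ n F
    rw [numTrees_rcls, F.fullRoots_card_eq_one]
    rintro ⟨v₀, h₀, h⟩
    exact F.exists_tree h₀ h

/-- The number of edges descends to the quotient, so identifying the one-vertex tree with `1` does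
not make any forest with edges trivial. This lets the case `c = 1` be tested on a representative. -/
theorem RClass.eq_one_iff {D : Type*} (c : RClass D) : c = 1 ↔ c.numEdges = 0 := by
  constructor
  · rintro rfl
    simp [numEdges]
  · induction c using RClass.ind with | _ n F
    rw [numEdges_rcls, Finset.card_eq_zero]
    exact F.rcls_eq_one

theorem RClass.numTrees_eq_zero {D : Type*} (c : RClass D) : c.numTrees = 0 ↔ c = 1 := by
  constructor
  · induction c using RClass.ind with | _ n F
    rw [numTrees_rcls, Finset.card_eq_zero, RForest.fullRoots_eq_empty]
    exact F.rcls_eq_one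
  · rintro rfl
    simp [numTrees]

/-! ### Iterated restriction and contraction; coassociativity and multiplicativity as identities of
sums. -/

namespace RForest

section PartCont

variable {D V : Type*} [DecidableEq V]

theorem part_parent_eq_none (F : RForest D V) (e : Finset V) (v : V) :
    (F.part e).parent v = none ↔ (v ∈ e → F.parent v = none) := by
  simp [part]

theorem part_part (F : RForest D V) {e g : Finset V} (h : e ⊆ g) :
    (F.part g).part e = F.part e := by
  ext1
  funext v
  by_cases hv : v ∈ e
  · simp [part, hv, h hv]
  · simp [part, hv]

theorem toCont_of_parent (F : RForest D V) {e : Finset V} {v w : V} {d : D} (hv : v ∈ e)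
    (h : F.parent v = some (w, d)) : F.toCont e v = F.toCont e w :=
  Subtype.ext ((F.part e).rootOf_of_some (d := d) (by simp [part, hv, h]))

theorem toCont_of_none (F : RForest D V) {e : Finset V} {v : V}
    (h : (F.part e).parent v = none) : F.toCont e v = ⟨v, h⟩ :=
  Subtype.ext ((F.part e).rootOf_of_none h)

/-- Restricting commutes with contracting. -/
theorem part_cont_isom (F : RForest D V) {e g : Finset V} (h : e ⊆ g)
    (f : Finset (F.ContVertex e)) (hf : ∀ v, v ∈ f ↔ v.1 ∈ g \ e) :
    ((F.part g).cont e).Isom ((F.cont e).part f) := by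
  have hp := F.part_part h
  refine ⟨Equiv.subtypeEquivRight fun v => by rw [hp], fun v => ?_⟩
  have ht : ∀ x, (Equiv.subtypeEquivRight fun v => by rw [hp]) ((F.part g).toCont e x) =
      F.toCont e x := fun x => Subtype.ext (by simp [toCont, hp])
  have hv : (F.part e).parent v.1 = none := hp ▸ v.2
  rw [part_parent_eq_none] at hv
  change (if _ ∈ f then (F.parent v.1).map _ else none) =
    Option.map _ (Option.map _ (if v.1 ∈ g then F.parent v.1 else none))
  simp only [hf, Equiv.subtypeEquivRight_apply_coe, Finset.mem_sdiff]
  by_cases hg : v.1 ∈ g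
  · by_cases he : v.1 ∈ e
    · simp [hv he]
    · rcases hw : F.parent v.1 with _ | ⟨w, d⟩
      · simp
      · simp [hg, he, ht]
  · simp [hg]

/-- Contracting in two steps. -/
theorem cont_cont_isom (F : RForest D V) {e g : Finset V} (h : e ⊆ g)
    (f : Finset (F.ContVertex e)) [DecidableEq (F.ContVertex e)]
    (hf : ∀ v, v ∈ f ↔ v.1 ∈ g \ e) :
    ((F.cont e).cont f).Isom (F.cont g) := by
  have h1 : ∀ v : F.ContVertex e, ((F.cont e).part f).parent v = none ↔
      (F.part g).parent v.1 = none := by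
    intro v
    have hv := v.2
    rw [part_parent_eq_none] at hv ⊢
    rw [part_parent_eq_none, hf, Finset.mem_sdiff]
    simp only [cont, Option.map_eq_none_iff]
    tauto
  have h2 : ∀ v, (F.part g).parent v = none → (F.part e).parent v = none := by
    intro v hv
    rw [part_parent_eq_none] at hv ⊢
    exact fun h' => hv (h h')
  let σ : (F.cont e).ContVertex f ≃ F.ContVertex g :=
    { toFun := fun v => ⟨v.1.1, (h1 v.1).1 v.2⟩
      invFun := fun v => ⟨⟨v.1, h2 _ v.2⟩, (h1 _).2 v.2⟩
      left_inv := fun v => rfl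
      right_inv := fun v => rfl }
  -- A component of `Part_g(F)` is represented by its root, and the same vertex is reached by
  -- following first the edges of `e` and then those of `f`; this is seen by going down from `x`.
  have ht : ∀ x, σ ((F.cont e).toCont f (F.toCont e x)) = F.toCont g x := by
    intro x
    induction x using F.induct with
    | h0 v hv =>
      have hg : (F.part g).parent v = none := by rw [part_parent_eq_none]; exact fun _ => hv
      rw [F.toCont_of_none (h2 v hg), F.toCont_of_none hg, toCont_of_none _ ((h1 _).2 hg)]
      rfl
    | h1 v w d hv ih =>
      by_cases hg : v ∈ g
      · rw [F.toCont_of_parent hg hv, ← ih]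
        by_cases he : v ∈ e
        · rw [F.toCont_of_parent he hv]
        · have he' : (F.part e).parent v = none := by
            rw [part_parent_eq_none]; exact fun h => absurd h he
          rw [F.toCont_of_none he', (F.cont e).toCont_of_parent (v := ⟨v, he'⟩)
            (w := F.toCont e w) (d := d)]
          · rw [hf, Finset.mem_sdiff]; exact ⟨hg, he⟩
          · simp [cont, hv]
      · have hg' : (F.part g).parent v = none := by
          rw [part_parent_eq_none]; exact fun h => absurd h hg
        rw [F.toCont_of_none (h2 v hg'), F.toCont_of_none hg', toCont_of_none _ ((h1 _).2 hg')]
        rfl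
  refine ⟨σ, fun v => ?_⟩
  change (F.parent v.1.1).map _ = Option.map _ (Option.map _ ((F.parent v.1.1).map _))
  rcases F.parent v.1.1 with _ | ⟨w, d⟩
  · rfl
  · simp [ht]

theorem cont_empty_isom (F : RForest D V) : (F.cont ∅).Isom F := by
  have hp : ∀ v, (F.part ∅).parent v = none := by simp [part]
  refine ⟨Equiv.subtypeUnivEquiv hp, fun v => ?_⟩
  change F.parent v.1 = Option.map _ ((F.parent v.1).map _)
  rcases F.parent v.1 with _ | ⟨w, d⟩
  · rfl
  · simp [F.toCont_of_none (hp w)]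

end PartCont

section Sums

variable {D V W : Type*} [Fintype V] [DecidableEq V] [Fintype W] [DecidableEq W]

theorem edges_part (F : RForest D V) (e : Finset V) : (F.part e).edges = F.edges ∩ e := by
  ext v
  by_cases hv : v ∈ e <;> simp [mem_edges, part, hv]

theorem part_edges (F : RForest D V) : F.part F.edges = F := by
  ext1
  funext v
  by_cases hv : v ∈ F.edges
  · simp [part, hv]
  · have h : F.parent v = none := by simpa [mem_edges] using hv
    simp [part, h]

theorem card_edges_cont (F : RForest D V) (e : Finset V) :
    (F.cont e).edges.card = (F.edges \ e).card := by
  rw [← Finset.card_map (Function.Embedding.subtype _)]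
  congr 1
  ext v
  simp only [Finset.mem_map, mem_edges_cont, Function.Embedding.subtype_apply, Subtype.exists,
    exists_and_left, exists_prop, exists_eq_right_right, and_iff_left_iff_imp]
  intro h
  rw [part_parent_eq_none]
  exact fun h' => absurd h' (Finset.mem_sdiff.1 h).2

theorem rcls_part_empty (F : RForest D V) : (F.part ∅).rcls = 1 :=
  rcls_eq_one _ (by simp [edges_part])

theorem rcls_cont_empty (F : RForest D V) : (F.cont ∅).rcls = F.rcls :=
  rcls_eq F.cont_empty_isom

theorem rcls_cont_edges (F : RForest D V) : (F.cont F.edges).rcls = 1 :=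
  rcls_eq_one _ (Finset.card_eq_zero.1 (by rw [card_edges_cont]; simp))

/-- The coassociativity of the contraction coproduct. -/
theorem sum_part_cont_cont {M : Type*} [AddCommMonoid M] (F : RForest D V)
    (T : RClass D → RClass D → RClass D → M) :
    ∑ e ∈ F.edges.powerset, ∑ f ∈ (F.cont e).edges.powerset,
        T (F.part e).rcls ((F.cont e).part f).rcls ((F.cont e).cont f).rcls =
      ∑ g ∈ F.edges.powerset, ∑ e ∈ (F.part g).edges.powerset,
        T ((F.part g).part e).rcls ((F.part g).cont e).rcls (F.cont g).rcls := by
  -- Both sides are sums over the pairs `e ⊆ g`: the set `f` of edges of `Cont_e(F)` corresponds to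
  -- `g \ e`.
  rw [Finset.sum_sigma', Finset.sum_sigma']
  have key : ∀ (e : Finset V) (f : Finset (F.ContVertex e)), f ⊆ (F.cont e).edges →
      ∀ v : F.ContVertex e,
        v ∈ f ↔ v.1 ∈ (e ∪ f.map (Function.Embedding.subtype _)) \ e := by
    intro e f hf v
    simp only [Finset.mem_sdiff, Finset.mem_union, Finset.mem_map,
      Function.Embedding.subtype_apply]
    constructor
    · intro hv
      have := (Finset.mem_sdiff.1 ((F.mem_edges_cont e v).1 (hf hv))).2
      exact ⟨Or.inr ⟨v, hv, rfl⟩, this⟩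
    · rintro ⟨h | ⟨w, hw, hwv⟩, h'⟩
      · exact absurd h h'
      · exact (Subtype.ext hwv) ▸ hw
  refine Finset.sum_bij'
    (fun x _ => ⟨x.1 ∪ x.2.map (Function.Embedding.subtype _), x.1⟩)
    (fun x _ => ⟨x.2, (x.1 \ x.2).subtype _⟩) ?_ ?_ ?_ ?_ ?_
  · rintro ⟨e, f⟩ h
    simp only [Finset.mem_sigma, Finset.mem_powerset, edges_part] at h ⊢
    have h1 : e ∪ f.map (Function.Embedding.subtype _) ⊆ F.edges := by
      refine Finset.union_subset h.1 fun v hv => ?_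
      obtain ⟨w, hw, rfl⟩ := Finset.mem_map.1 hv
      exact (Finset.mem_sdiff.1 ((F.mem_edges_cont e w).1 (h.2 hw))).1
    exact ⟨h1, Finset.subset_inter h.1 Finset.subset_union_left⟩
  · rintro ⟨g, e⟩ h
    simp only [Finset.mem_sigma, Finset.mem_powerset, edges_part] at h ⊢
    refine ⟨h.2.trans Finset.inter_subset_left, fun v hv => ?_⟩
    rw [mem_edges_cont]
    rw [Finset.mem_subtype] at hv
    exact Finset.sdiff_subset_sdiff h.1 subset_rfl hv
  · rintro ⟨e, f⟩ h
    simp only [Finset.mem_sigma, Finset.mem_powerset] at h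
    refine Sigma.ext rfl (heq_of_eq ?_)
    ext v
    rw [Finset.mem_subtype]
    exact (key e f h.2 v).symm
  · rintro ⟨g, e⟩ h
    simp only [Finset.mem_sigma, Finset.mem_powerset, edges_part] at h
    refine Sigma.ext ?_ (heq_of_eq rfl)
    ext v
    simp only [Finset.mem_union, Finset.mem_map, Finset.mem_subtype,
      Function.Embedding.subtype_apply]
    constructor
    · rintro (hv | ⟨w, hw, rfl⟩)
      · exact (Finset.mem_inter.1 (h.2 hv)).2
      · exact (Finset.mem_sdiff.1 hw).1
    · intro hv
      by_cases he : v ∈ e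
      · exact Or.inl he
      · refine Or.inr ⟨⟨v, ?_⟩, Finset.mem_sdiff.2 ⟨hv, he⟩, rfl⟩
        rw [part_parent_eq_none]
        exact fun h' => absurd h' he
  · rintro ⟨e, f⟩ h
    simp only [Finset.mem_sigma, Finset.mem_powerset] at h
    have hk := key e f h.2
    simp only
    rw [rcls_eq (F.part_cont_isom Finset.subset_union_left f hk),
      rcls_eq (F.cont_cont_isom Finset.subset_union_left f hk),
      F.part_part Finset.subset_union_left]

/-- The contraction coproduct is multiplicative. -/
theorem sum_part_cont_add {M : Type*} [AddCommMonoid M] (F : RForest D V) (G : RForest D W)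
    (T : RClass D → RClass D → M) :
    ∑ h ∈ (F.add G).edges.powerset, T ((F.add G).part h).rcls ((F.add G).cont h).rcls =
      ∑ e ∈ F.edges.powerset, ∑ f ∈ G.edges.powerset,
        T ((F.part e).rcls * (G.part f).rcls) ((F.cont e).rcls * (G.cont f).rcls) := by
  rw [← Finset.sum_product', edges_add]
  symm
  refine Finset.sum_bij' (fun e _ => e.1.disjSum e.2) (fun f _ => (f.toLeft, f.toRight))
    ?_ ?_ ?_ ?_ ?_
  · intro e he
    rw [Finset.mem_product, Finset.mem_powerset, Finset.mem_powerset] at he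
    exact Finset.mem_powerset.2 (Finset.disjSum_mono he.1 he.2)
  · intro f hf
    rw [Finset.mem_powerset] at hf
    rw [Finset.mem_product, Finset.mem_powerset, Finset.mem_powerset]
    exact ⟨fun v hv => by simpa using hf (Finset.mem_toLeft.1 hv),
      fun v hv => by simpa using hf (Finset.mem_toRight.1 hv)⟩
  · intro e _
    simp
  · intro f _
    exact Finset.toLeft_disjSum_toRight
  · intro e _
    rw [rcls_eq (F.cont_add G e.1 e.2), part_add, rcls_add, rcls_add]

/-- Splitting off connected components, where vertices without edges do not matter. -/
theorem rcls_eq_part_mul_part (F : RForest D V) (e : Finset V)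
    (he : ∀ v w d, F.parent v = some (w, d) → ∀ x ∈ e, F.rootOf x = F.rootOf v → v ∈ e) :
    F.rcls = (F.part e).rcls * (F.part (F.edges \ e)).rcls := by
  classical
  -- The product lives on two copies of `V`, so `F` is padded with a second copy of `V` without
  -- edges. The involution `σ` exchanges the two copies of exactly those components that do not meet
  -- `e`.
  let P : V → Prop := fun v => ∃ x ∈ e, F.rootOf x = F.rootOf v
  let σ : V ⊕ V → V ⊕ V :=
    Sum.elim (fun v => if P v then .inl v else .inr v) fun v => if P v then .inr v else .inl v
  have hσ : Function.Involutive σ := by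
    rintro (v | v) <;> by_cases hv : P v <;> simp [σ, hv]
  rw [← rcls_add, ← mul_one F.rcls, ← rcls_edgeless D V, ← rcls_add]
  refine rcls_eq ⟨hσ.toPerm, ?_⟩
  have hnot : ∀ v, ¬ P v → v ∉ e := fun v hv h => hv ⟨v, h, rfl⟩
  rintro (v | v)
  · simp only [Function.Involutive.coe_toPerm]
    rcases hw : F.parent v with _ | ⟨w, d⟩
    · by_cases hv : P v <;> simp [σ, hv, add, part, hw]
    · have hm : v ∈ F.edges := by simp [mem_edges, hw]
      have hP : P w ↔ P v := by simp only [P, F.rootOf_of_some hw]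
      by_cases hv : P v
      · have hv' : v ∈ e := by
          obtain ⟨x, hx, hxv⟩ := hv
          exact he v w d hw x hx hxv
        simp [σ, hv, hP, add, part, hw, hv']
      · simp [σ, hv, hP, add, part, hw, hnot v hv, hm]
  · simp only [Function.Involutive.coe_toPerm]
    by_cases hv : P v
    · have : v ∈ F.edges \ e → F.parent v = none := by
        intro h
        by_contra hc
        obtain ⟨⟨w, d⟩, hw⟩ := Option.ne_none_iff_exists'.1 hc
        obtain ⟨x, hx, hxv⟩ := hv
        exact (Finset.mem_sdiff.1 h).2 (he v w d hw x hx hxv)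
      have h' := (F.part_parent_eq_none (F.edges \ e) v).2 this
      simp [σ, hv, add, edgeless, h']
    · have h' : (F.part e).parent v = none := by simp [part, hnot v hv]
      simp [σ, hv, add, edgeless, h']

end Sums

end RForest

/-- A class of forests with at least two nonempty trees is a product of two nontrivial classes. -/
theorem RClass.exists_mul {D : Type*} (c : RClass D) (h1 : c ≠ 1) (h : c.numTrees ≠ 1) :
    ∃ a b : RClass D, a ≠ 1 ∧ b ≠ 1 ∧ c = a * b := by
  classical
  induction c using RClass.ind with | _ n F
  have hne : F.edges ≠ ∅ := fun h => h1 (F.rcls_eq_one h)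
  obtain ⟨v₀, h₀⟩ := Finset.nonempty_iff_ne_empty.2 hne
  let e := F.edges.filter fun v => F.rootOf v = F.rootOf v₀
  rw [numTrees_rcls, ne_eq, F.fullRoots_card_eq_one] at h
  push Not at h
  obtain ⟨v₁, h₁, h₁₀⟩ := h v₀ h₀
  refine ⟨(F.part e).rcls, (F.part (F.edges \ e)).rcls, ?_, ?_, F.rcls_eq_part_mul_part e ?_⟩
  · rw [ne_eq, RClass.eq_one_iff, numEdges_rcls, RForest.edges_part, Finset.card_eq_zero]
    exact Finset.ne_empty_of_mem (a := v₀) (by simp [e, h₀])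
  · rw [ne_eq, RClass.eq_one_iff, numEdges_rcls, RForest.edges_part, Finset.card_eq_zero]
    exact Finset.ne_empty_of_mem (a := v₁) (by simp [e, h₁, h₁₀])
  · intro v w d hv x hx hxv
    simp only [e, Finset.mem_filter] at hx ⊢
    exact ⟨by simp [RForest.mem_edges, hv], hxv ▸ hx.2⟩

/-! ### Linear maps on `CCK K D`, and `φ` extended by zero. -/

open CoalgebraStruct

noncomputable instance (D : Type*) : DecidableEq (RClass D) := Classical.decEq _

namespace CCK

variable {K : Type*} [Field K] {D : Type*}

theorem induction_of {P : CCK K D → Prop} (x : CCK K D) (of : ∀ c, P (CCK.of K D c))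
    (add : ∀ x y, P x → P y → P (x + y)) (smul : ∀ (r : K) x, P x → P (r • x)) : P x :=
  MonoidAlgebra.induction_on (motive := P) x of add smul

theorem hom_ext {M : Type*} [AddCommMonoid M] [Module K M] {f g : CCK K D →ₗ[K] M}
    (h : ∀ c, f (CCK.of K D c) = g (CCK.of K D c)) : f = g := by
  ext x
  induction x using CCK.induction_of with
  | of c => exact h c
  | add x y hx hy => rw [map_add, map_add, hx, hy]
  | smul r x hx => rw [map_smul, map_smul, hx]

/-- The linear extension to `CCK K D` of a map defined on classes of forests. -/
noncomputable def extend {M : Type*} [AddCommMonoid M] [Module K M] (f : RClass D → M) :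
    CCK K D →ₗ[K] M :=
  Finsupp.linearCombination K f ∘ₗ (MonoidAlgebra.coeffLinearEquiv K).toLinearMap

@[simp] theorem extend_of {M : Type*} [AddCommMonoid M] [Module K M] (f : RClass D → M)
    (c : RClass D) : extend f (CCK.of K D c) = f c :=
  (Finsupp.linearCombination_single K 1 c).trans (one_smul K (f c))

theorem counit_of (c : RClass D) :
    counit (R := K) (CCK.of K D c) = if c = 1 then 1 else 0 := by
  induction c using RClass.ind with | _ n F
  rw [show CCK.of K D F.rcls = F.toCCK K from rfl, CCK.counit_toCCK]
  congr 1
  rw [RClass.eq_one_iff, RClass.numEdges_rcls, Finset.card_eq_zero]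

theorem incl_single (t : NTree D) : incl K D (Finsupp.single t 1) = CCK.of K D t.1 :=
  (Finsupp.linearCombination_single K 1 t).trans (one_smul K _)

end CCK

open Classical in
/-- The linear map `φ` on classes of forests, extended by zero to the forests that are not nonempty
trees. -/
noncomputable def letter {K : Type*} [Field K] {D : Type*}
    (φ : (NTree D →₀ K) →ₗ[K] (D →₀ K)) (c : RClass D) : D →₀ K :=
  if h : ∃ (n : ℕ) (T : RForest D (Fin n)), T.IsTree ∧ T.edges.Nonempty ∧ T.rcls = c then
    φ (Finsupp.single ⟨c, h⟩ 1) else 0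

section Letter

variable {K : Type*} [Field K] {D : Type*} (φ : (NTree D →₀ K) →ₗ[K] (D →₀ K))

theorem letter_tree (t : NTree D) : letter φ t.1 = φ (Finsupp.single t 1) :=
  dif_pos t.2

theorem letter_of_numTrees_ne_one {c : RClass D} (h : c.numTrees ≠ 1) : letter φ c = 0 :=
  dif_neg (by rwa [RClass.exists_tree_iff])

theorem letter_one : letter φ (1 : RClass D) = 0 :=
  letter_of_numTrees_ne_one φ (by rw [(RClass.numTrees_eq_zero 1).2 rfl]; decide)

/-- Numbers of nonempty trees add up, so a product of nontrivial classes has at least two of them.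
This is the source of the multiplicativity of the solution. -/
theorem letter_mul_of_ne_one {a b : RClass D} (ha : a ≠ 1) (hb : b ≠ 1) :
    letter φ (a * b) = 0 := by
  rw [ne_eq, ← RClass.numTrees_eq_zero] at ha hb
  exact letter_of_numTrees_ne_one φ (by rw [RClass.numTrees_mul]; omega)

theorem letter_part_empty {V : Type*} [Fintype V] [DecidableEq V] (F : RForest D V) :
    letter φ (F.part ∅).rcls = 0 := by
  rw [F.rcls_part_empty, letter_one]

/-! ### Existence: the recursion on first letters and its solution. -/

/-- The approximations of the solution of `Φ = ε + (letter ⊗ Φ) ∘ Δ`. -/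
noncomputable def approx : ℕ → (CCK K D →ₗ[K] Sh K D)
  | 0 => LinearMap.toSpanSingleton K (Sh K D) 1 ∘ₗ counit
  | n + 1 => LinearMap.toSpanSingleton K (Sh K D) 1 ∘ₗ counit +
      TensorProduct.lift (Sh.consL.compl₁₂ (CCK.extend (letter φ)) (approx n)) ∘ₗ comul

theorem approx_zero_of (c : RClass D) :
    approx φ 0 (CCK.of K D c) = if c = 1 then 1 else 0 := by
  rw [approx, LinearMap.comp_apply, CCK.counit_of, LinearMap.toSpanSingleton_apply, ite_smul,
    one_smul, zero_smul]

theorem approx_succ_of {V : Type*} [Fintype V] [DecidableEq V] (n : ℕ) (F : RForest D V) :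
    approx φ (n + 1) (CCK.of K D F.rcls) = (if F.rcls = 1 then 1 else 0) +
      ∑ e ∈ F.edges.powerset,
        Sh.consL (letter φ (F.part e).rcls) (approx φ n (CCK.of K D (F.cont e).rcls)) := by
  rw [← approx_zero_of φ, approx, approx, LinearMap.add_apply]
  congr 1
  rw [LinearMap.comp_apply, show CCK.of K D F.rcls = F.toCCK K from rfl, CCK.comul_toCCK,
    RForest.coprod, map_sum]
  refine Finset.sum_congr rfl fun e _ => ?_
  simp [RForest.toCCK]

/-- The term `e = ∅` vanishes, so each step of the recursion contracts at least one edge: for a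
class with at most `m` edges, `m` steps suffice. -/
theorem approx_eq_of_le (m n : ℕ) (hmn : m ≤ n) (c : RClass D) (hc : c.numEdges ≤ m) :
    approx φ n (CCK.of K D c) = approx φ m (CCK.of K D c) := by
  induction m generalizing n c with
  | zero =>
    cases n with
    | zero => rfl
    | succ n =>
      induction c using RClass.ind with | _ k F
      rw [RClass.numEdges_rcls, Nat.le_zero, Finset.card_eq_zero] at hc
      rw [approx_succ_of, approx_zero_of, hc]
      simp [letter_part_empty]
  | succ m ih =>
    cases n with
    | zero => omega
    | succ n =>
      induction c using RClass.ind with | _ k F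
      rw [RClass.numEdges_rcls] at hc
      rw [approx_succ_of, approx_succ_of]
      congr 1
      refine Finset.sum_congr rfl fun e he => ?_
      rcases e.eq_empty_or_nonempty with rfl | hne
      · simp [letter_part_empty]
      · rw [ih n (by omega)]
        rw [RClass.numEdges_rcls, RForest.card_edges_cont,
          Finset.card_sdiff_of_subset (Finset.mem_powerset.1 he)]
        have := hne.card_pos
        omega

/-- The solution of `Φ = ε + (letter ⊗ Φ) ∘ Δ`, on classes of forests. -/
noncomputable def solution (c : RClass D) : Sh K D := approx φ c.numEdges (CCK.of K D c)

theorem solution_rcls {V : Type*} [Fintype V] [DecidableEq V] (F : RForest D V) :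
    solution φ F.rcls = (if F.rcls = 1 then 1 else 0) +
      ∑ e ∈ F.edges.powerset,
        Sh.consL (letter φ (F.part e).rcls) (solution φ (F.cont e).rcls) := by
  rw [solution, ← approx_eq_of_le φ _ _ (Nat.le_succ _) _ le_rfl, approx_succ_of]
  congr 1
  refine Finset.sum_congr rfl fun e _ => ?_
  rw [solution, approx_eq_of_le φ (F.cont e).rcls.numEdges F.rcls.numEdges _ _ le_rfl]
  rw [RClass.numEdges_rcls, RClass.numEdges_rcls, RForest.card_edges_cont]
  exact Finset.card_le_card Finset.sdiff_subset

/-- The recursion determines its solution. -/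
theorem eq_solution {g : RClass D → Sh K D}
    (hg : ∀ (n : ℕ) (F : RForest D (Fin n)), g F.rcls = (if F.rcls = 1 then 1 else 0) +
      ∑ e ∈ F.edges.powerset, Sh.consL (letter φ (F.part e).rcls) (g (F.cont e).rcls))
    (c : RClass D) : g c = solution φ c := by
  induction h : c.numEdges using Nat.strong_induction_on generalizing c with
  | _ m ih =>
    induction c using RClass.ind with | _ n F
    rw [hg, solution_rcls]
    congr 1
    refine Finset.sum_congr rfl fun e he => ?_
    rcases e.eq_empty_or_nonempty with rfl | hne
    · simp [letter_part_empty]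
    · rw [ih _ _ _ rfl]
      rw [← h, RClass.numEdges_rcls, RClass.numEdges_rcls, RForest.card_edges_cont]
      have := hne.card_pos
      have := Finset.card_le_card (Finset.mem_powerset.1 he)
      rw [Finset.card_sdiff_of_subset (Finset.mem_powerset.1 he)]
      omega

theorem solution_one : solution φ (1 : RClass D) = 1 := by
  have h := (RClass.eq_one_iff (1 : RClass D)).1 rfl
  rw [solution, h, approx_zero_of, if_pos rfl]

theorem counit_solution (c : RClass D) :
    counit (R := K) (solution φ c) = if c = 1 then 1 else 0 := by
  induction c using RClass.ind with | _ n F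
  rw [solution_rcls, map_add, map_sum, Finset.sum_eq_zero fun e _ => Sh.counit_consL _ _, add_zero]
  split_ifs
  · exact Sh.counit_one
  · exact map_zero _

theorem RForest.rcls_part_eq_one_iff {V : Type*} [Fintype V] [DecidableEq V] (F : RForest D V)
    {e : Finset V} (he : e ⊆ F.edges) : (F.part e).rcls = 1 ↔ e = ∅ := by
  rw [RClass.eq_one_iff, RClass.numEdges_rcls, Finset.card_eq_zero, RForest.edges_part,
    Finset.inter_eq_right.2 he]

theorem RForest.rcls_cont_eq_one_iff {V : Type*} [Fintype V] [DecidableEq V] (F : RForest D V)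
    {e : Finset V} (he : e ⊆ F.edges) : (F.cont e).rcls = 1 ↔ e = F.edges := by
  rw [RClass.eq_one_iff, RClass.numEdges_rcls, RForest.card_edges_cont, Finset.card_eq_zero,
    Finset.sdiff_eq_empty_iff_subset]
  exact ⟨fun h => he.antisymm h, fun h => h.ge⟩

/-- A one-letter word arises only when `Cont_e(F)` contributes the empty word, which forces `e =
E(F)` and hence `Part_e(F) = F`. -/
theorem proj_solution (c : RClass D) : Sh.proj K (solution φ c) = letter φ c := by
  induction c using RClass.ind with | _ n F
  rw [solution_rcls, map_add, map_sum]
  have h1 : Sh.proj K (if F.rcls = 1 then (1 : Sh K D) else 0) = 0 := by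
    split_ifs
    · exact Sh.proj_one
    · exact map_zero _
  rw [h1, zero_add, Finset.sum_eq_single F.edges]
  · rw [Sh.proj_consL, counit_solution, F.rcls_cont_edges, if_pos rfl, one_smul, F.part_edges]
  · intro e he hne
    rw [Sh.proj_consL, counit_solution,
      if_neg (mt (F.rcls_cont_eq_one_iff (Finset.mem_powerset.1 he)).1 hne), zero_smul]
  · intro h
    exact absurd (Finset.mem_powerset_self _) h

/-- When the coproduct is applied to the recursion, the cuts before the first letter add up to `1 ⊗
Φ(F)`. The other cuts are handled by induction on `Cont_e(F)`; coassociativity turns them into `∑_g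
(Φ - ε)(Part_g F) ⊗ Φ(Cont_g F)`, and its correction term is again `1 ⊗ Φ(F)`, which cancels. -/
theorem comul_solution {V : Type*} [Fintype V] [DecidableEq V] (F : RForest D V) :
    comul (R := K) (solution φ F.rcls) =
      ∑ e ∈ F.edges.powerset, solution φ (F.part e).rcls ⊗ₜ[K] solution φ (F.cont e).rcls := by
  -- The vertex type must vary, since `Cont_e(F)` lives on a subtype of `V`.
  induction h : F.edges.card using Nat.strong_induction_on generalizing V with
  | _ m ih =>
  have h1 : ∀ e ∈ F.edges.powerset,
      TensorProduct.map (Sh.consL (letter φ (F.part e).rcls)) LinearMap.id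
        (comul (R := K) (solution φ (F.cont e).rcls)) =
      ∑ f ∈ (F.cont e).edges.powerset, Sh.consL (letter φ (F.part e).rcls)
        (solution φ ((F.cont e).part f).rcls) ⊗ₜ[K] solution φ ((F.cont e).cont f).rcls := by
    intro e he
    rcases e.eq_empty_or_nonempty with rfl | hne
    · simp [letter_part_empty]
    · rw [ih _ _ (F.cont e) rfl, map_sum]
      · rfl
      · rw [← h, RForest.card_edges_cont]
        have := hne.card_pos
        have := Finset.card_le_card (Finset.mem_powerset.1 he)
        rw [Finset.card_sdiff_of_subset (Finset.mem_powerset.1 he)]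
        omega
  -- This is the recursion for `Part_g(F)` read backwards. Its counit term is present only for `g =
  -- ∅`, where `Cont_g(F)` is `F`.
  have h2 : ∀ g ∈ F.edges.powerset,
      ∑ e ∈ (F.part g).edges.powerset, Sh.consL (letter φ ((F.part g).part e).rcls)
        (solution φ ((F.part g).cont e).rcls) ⊗ₜ[K] solution φ (F.cont g).rcls =
      solution φ (F.part g).rcls ⊗ₜ[K] solution φ (F.cont g).rcls -
        if g = ∅ then 1 ⊗ₜ[K] solution φ F.rcls else 0 := by
    intro g hg
    rw [← TensorProduct.sum_tmul, solution_rcls φ (F.part g), TensorProduct.add_tmul]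
    simp only [F.rcls_part_eq_one_iff (Finset.mem_powerset.1 hg)]
    by_cases h0 : g = ∅
    · subst h0
      simp [F.rcls_cont_empty]
    · simp [h0]
  have h3 : comul (R := K) (if F.rcls = 1 then (1 : Sh K D) else 0) =
      1 ⊗ₜ[K] (if F.rcls = 1 then (1 : Sh K D) else 0) := by
    split_ifs
    · exact Sh.comul_one
    · simp
  conv_lhs => rw [solution_rcls φ F]
  rw [map_add, map_sum, h3]
  simp only [Sh.comul_consL]
  rw [Finset.sum_add_distrib, ← TensorProduct.tmul_sum, ← add_assoc, ← TensorProduct.tmul_add,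
    ← solution_rcls φ F, Finset.sum_congr rfl h1,
    F.sum_part_cont_cont fun a b c => Sh.consL (letter φ a) (solution φ b) ⊗ₜ[K] solution φ c,
    Finset.sum_congr rfl h2, Finset.sum_sub_distrib, Finset.sum_ite_eq']
  simp

theorem letter_mul (a b : RClass D) : letter φ (a * b) =
    (if b = 1 then letter φ a else 0) + if a = 1 then letter φ b else 0 := by
  by_cases ha : a = 1
  · by_cases hb : b = 1
    · simp [ha, hb, letter_one]
    · simp [ha, hb]
  · by_cases hb : b = 1
    · simp [ha, hb]
    · simp [ha, hb, letter_mul_of_ne_one φ ha hb]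

/-- In the recursion for `F G`, indexed by pairs `(e, f)`, the letter vanishes unless `e` or `f` is
empty. So the first letter comes from exactly one factor, just as in the recursion for shuffles;
induction on the total number of edges applies to what follows it. -/
theorem solution_mul (a b : RClass D) :
    solution φ (a * b) = solution φ a * solution φ b := by
  induction h : a.numEdges + b.numEdges using Nat.strong_induction_on generalizing a b with
  | _ m ih =>
  induction a using RClass.ind with | _ k F
  induction b using RClass.ind with | _ l G
  rw [RClass.numEdges_rcls, RClass.numEdges_rcls] at h
  have hsum : solution φ (F.rcls * G.rcls) =
      (if F.rcls * G.rcls = 1 then 1 else 0) +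
        (∑ e ∈ F.edges.powerset, Sh.consL (letter φ (F.part e).rcls)
            (solution φ ((F.cont e).rcls * G.rcls)) +
          ∑ f ∈ G.edges.powerset, Sh.consL (letter φ (G.part f).rcls)
            (solution φ (F.rcls * (G.cont f).rcls))) := by
    rw [← RForest.rcls_add, solution_rcls,
      F.sum_part_cont_add G fun a b => Sh.consL (letter φ a) (solution φ b)]
    congr 1
    simp only [letter_mul, map_add, LinearMap.add_apply, Finset.sum_add_distrib]
    congr 1
    · refine Finset.sum_congr rfl fun e _ => ?_
      rw [Finset.sum_eq_single ∅]
      · rw [G.rcls_part_empty, if_pos rfl, G.rcls_cont_empty]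
      · intro f hf hne
        rw [if_neg (mt (G.rcls_part_eq_one_iff (Finset.mem_powerset.1 hf)).1 hne)]
        simp
      · intro h
        exact absurd (Finset.empty_mem_powerset _) h
    · rw [Finset.sum_eq_single ∅]
      · refine Finset.sum_congr rfl fun f _ => ?_
        rw [F.rcls_part_empty, if_pos rfl, F.rcls_cont_empty]
      · intro e he hne
        refine Finset.sum_eq_zero fun f _ => ?_
        rw [if_neg (mt (F.rcls_part_eq_one_iff (Finset.mem_powerset.1 he)).1 hne)]
        simp
      · intro h
        exact absurd (Finset.empty_mem_powerset _) h
  have hF : ∀ e ∈ F.edges.powerset, Sh.consL (letter φ (F.part e).rcls)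
      (solution φ ((F.cont e).rcls * G.rcls)) = Sh.consL (letter φ (F.part e).rcls)
      (solution φ (F.cont e).rcls * solution φ G.rcls) := by
    intro e he
    rcases e.eq_empty_or_nonempty with rfl | hne
    · simp [letter_part_empty]
    · rw [ih _ _ _ _ rfl]
      rw [← h, RClass.numEdges_rcls, RClass.numEdges_rcls, RForest.card_edges_cont,
        Finset.card_sdiff_of_subset (Finset.mem_powerset.1 he)]
      have := hne.card_pos
      have := Finset.card_le_card (Finset.mem_powerset.1 he)
      omega
  have hG : ∀ f ∈ G.edges.powerset, Sh.consL (letter φ (G.part f).rcls)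
      (solution φ (F.rcls * (G.cont f).rcls)) = Sh.consL (letter φ (G.part f).rcls)
      (solution φ F.rcls * solution φ (G.cont f).rcls) := by
    intro f hf
    rcases f.eq_empty_or_nonempty with rfl | hne
    · simp [letter_part_empty]
    · rw [ih _ _ _ _ rfl]
      rw [← h, RClass.numEdges_rcls, RClass.numEdges_rcls, RForest.card_edges_cont,
        Finset.card_sdiff_of_subset (Finset.mem_powerset.1 hf)]
      have := hne.card_pos
      have := Finset.card_le_card (Finset.mem_powerset.1 hf)
      omega
  rw [hsum, Finset.sum_congr rfl hF, Finset.sum_congr rfl hG]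
  have hone : F.rcls * G.rcls = 1 ↔ F.rcls = 1 ∧ G.rcls = 1 := by
    simp only [RClass.eq_one_iff, RClass.numEdges_mul, Nat.add_eq_zero_iff]
  -- `X` and `Y` are the parts of the two factors without constant term. In the expansion of the
  -- product, the counit of one factor times the other part gives the mixed terms, and the remaining
  -- sums form `X * Y`.
  set X := ∑ e ∈ F.edges.powerset,
    Sh.consL (letter φ (F.part e).rcls) (solution φ (F.cont e).rcls) with hX
  set Y := ∑ f ∈ G.edges.powerset,
    Sh.consL (letter φ (G.part f).rcls) (solution φ (G.cont f).rcls) with hY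
  have hXY : X * Y = ∑ e ∈ F.edges.powerset, Sh.consL (letter φ (F.part e).rcls)
        (solution φ (F.cont e).rcls * Y) + ∑ f ∈ G.edges.powerset,
          Sh.consL (letter φ (G.part f).rcls) (X * solution φ (G.cont f).rcls) := by
    conv_lhs => rw [hX, hY, Finset.sum_mul_sum]
    simp only [Sh.consL_mul_consL, Finset.sum_add_distrib]
    congr 1
    · simp only [hY, Finset.mul_sum, map_sum]
    · rw [Finset.sum_comm]
      simp only [hX, Finset.sum_mul, map_sum]
  have hFX : solution φ F.rcls = (if F.rcls = 1 then 1 else 0) + X := solution_rcls φ F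
  have hGY : solution φ G.rcls = (if G.rcls = 1 then 1 else 0) + Y := solution_rcls φ G
  rw [hFX, hGY]
  simp only [mul_add, add_mul, map_add, Finset.sum_add_distrib, hXY]
  by_cases hF1 : F.rcls = 1 <;> by_cases hG1 : G.rcls = 1 <;>
    simp [hone, hF1, hG1, ← hX, ← hY] <;> abel

/-- The morphism with values in `Sh K D` given by `φ`. -/
noncomputable def solutionHom : CCK K D →ₐc[K] Sh K D :=
  let f : CCK K D →ₐ[K] Sh K D := MonoidAlgebra.lift K (Sh K D) (RClass D)
    { toFun := solution φ, map_one' := solution_one φ, map_mul' := solution_mul φ }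
  have hf : ∀ c, f (CCK.of K D c) = solution φ c := MonoidAlgebra.lift_of _
  { f with
    map_smul' := map_smul f
    counit_comp := CCK.hom_ext fun c =>
      (congrArg counit (hf c)).trans ((counit_solution φ c).trans (CCK.counit_of c).symm)
    map_comp_comul := CCK.hom_ext fun c => by
      induction c using RClass.ind with | _ n F
      refine Eq.trans ?_ ((comul_solution φ F).symm.trans (congrArg comul (hf F.rcls)).symm)
      rw [LinearMap.comp_apply, show CCK.of K D F.rcls = F.toCCK K from rfl, CCK.comul_toCCK,
        RForest.coprod, map_sum]
      exact Finset.sum_congr rfl fun e _ => congrArg₂ (fun x y => x ⊗ₜ[K] y) (hf _) (hf _) }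

theorem solutionHom_of (c : RClass D) : solutionHom φ (CCK.of K D c) = solution φ c :=
  MonoidAlgebra.lift_of (R := K) (A := Sh K D) _ c

theorem lifts_solutionHom : Lifts φ (solutionHom φ) := by
  intro x
  induction x using Finsupp.induction_linear with
  | zero => simp
  | add x y hx hy => simp only [map_add, hx, hy]
  | single t c =>
    have : Finsupp.single t c = c • Finsupp.single t (1 : K) := by simp
    rw [this, map_smul, map_smul, map_smul, map_smul, CCK.incl_single, solutionHom_of, proj_solution, letter_tree]

/-! ### Uniqueness, and the recursion on last letters. -/

variable {φ} {Φ : CCK K D →ₐc[K] Sh K D}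

theorem counit_hom_of (Φ : CCK K D →ₐc[K] Sh K D) (c : RClass D) :
    counit (R := K) (Φ (CCK.of K D c)) = if c = 1 then 1 else 0 :=
  (CoalgHomClass.counit_comp_apply Φ _).trans (CCK.counit_of c)

theorem comul_hom_rcls (Φ : CCK K D →ₐc[K] Sh K D) {V : Type*} [Fintype V] [DecidableEq V]
    (F : RForest D V) : comul (R := K) (Φ (CCK.of K D F.rcls)) =
      ∑ e ∈ F.edges.powerset,
        Φ (CCK.of K D (F.part e).rcls) ⊗ₜ[K] Φ (CCK.of K D (F.cont e).rcls) := by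
  rw [← CoalgHomClass.map_comp_comul_apply, show CCK.of K D F.rcls = F.toCCK K from rfl,
    CCK.comul_toCCK, RForest.coprod, map_sum]
  rfl

/-- The lifting property speaks only of trees. On `1` and on nontrivial products both sides vanish,
the left one because `proj` is a derivation with respect to the counit. -/
theorem Lifts.proj_of (h : Lifts φ Φ) (c : RClass D) :
    Sh.proj K (Φ (CCK.of K D c)) = letter φ c := by
  by_cases h1 : c = 1
  · rw [h1, map_one, map_one, Sh.proj_one, letter_one]
  by_cases ht : c.numTrees = 1
  · obtain ⟨t, rfl⟩ : ∃ t : NTree D, t.1 = c := ⟨⟨c, c.exists_tree_iff.2 ht⟩, rfl⟩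
    have := h (Finsupp.single t 1)
    rwa [CCK.incl_single, ← letter_tree] at this
  · obtain ⟨a, b, ha, hb, rfl⟩ := c.exists_mul h1 ht
    rw [letter_mul_of_ne_one φ ha hb, map_mul, map_mul, Sh.proj_mul, counit_hom_of, counit_hom_of,
      if_neg ha, if_neg hb, zero_smul, zero_smul, add_zero]

/-- Splitting the first letter off `Φ(F)` and using compatibility with the coproduct gives precisely
the recursion solved by `solution`. -/
theorem Lifts.eq_solutionHom (h : Lifts φ Φ) : Φ = solutionHom φ := by
  have key : ∀ c, Φ (CCK.of K D c) = solution φ c := by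
    refine eq_solution φ (g := fun c => Φ (CCK.of K D c)) fun n F => ?_
    rw [Sh.eq_counit_add_consL (Φ (CCK.of K D F.rcls)), counit_hom_of, comul_hom_rcls, map_sum,
      ite_smul, one_smul, zero_smul]
    congr 1
    refine Finset.sum_congr rfl fun e _ => ?_
    rw [TensorProduct.lift.tmul, LinearMap.comp_apply, h.proj_of]
  refine DFunLike.ext _ _ fun x => ?_
  induction x using CCK.induction_of with
  | of c => rw [key, solutionHom_of]
  | add x y hx hy => rw [map_add, map_add, hx, hy]
  | smul r x hx => rw [map_smul, map_smul, hx]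

/-- A lift is determined by splitting off the last letters. -/
theorem Lifts.snocL_rec (h : Lifts φ Φ) {V : Type*} [Fintype V] [DecidableEq V]
    (F : RForest D V) : Φ (F.toCCK K) = (if F.edges = ∅ then 1 else 0) +
      ∑ e ∈ F.edges.powerset,
        Sh.snocL (letter φ (F.cont e).rcls) (Φ ((F.part e).toCCK K)) := by
  rw [Sh.eq_counit_add_snocL (Φ (F.toCCK K)), RForest.toCCK, counit_hom_of, comul_hom_rcls,
    map_sum, ite_smul, one_smul, zero_smul]
  simp only [RClass.eq_one_iff, RClass.numEdges_rcls, Finset.card_eq_zero]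
  congr 1
  refine Finset.sum_congr rfl fun e _ => ?_
  rw [TensorProduct.lift.tmul, LinearMap.flip_apply, LinearMap.comp_apply, h.proj_of]
  rfl

end Letter

/-! ### Generalized partitions in terms of components of partial forests. -/

section BiUnion

variable {V : Type*} [DecidableEq V]

theorem biUnion_snoc {k : ℕ} (p : Fin k → Finset V) (e : Finset V) :
    Finset.univ.biUnion (Fin.snoc (α := fun _ => Finset V) p e) = Finset.univ.biUnion p ∪ e := by
  ext v
  simp [Fin.exists_fin_succ']

theorem biUnion_Iic_castSucc_snoc {k : ℕ} (p : Fin k → Finset V) (e : Finset V) (i : Fin k) :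
    (Finset.Iic i.castSucc).biUnion (Fin.snoc (α := fun _ => Finset V) p e) =
      (Finset.Iic i).biUnion p := by
  ext v
  simp [Fin.exists_fin_succ']

theorem biUnion_Iic_last_snoc {k : ℕ} (p : Fin k → Finset V) (e : Finset V) :
    (Finset.Iic (Fin.last k)).biUnion (Fin.snoc (α := fun _ => Finset V) p e) =
      Finset.univ.biUnion p ∪ e := by
  rw [← biUnion_snoc]
  congr 1
  ext i
  simp [Fin.le_last]

end BiUnion

namespace RForest

section Graph

variable {D V : Type*}

theorem reachable_rootOf (F : RForest D V) (v : V) : F.graph.Reachable v (F.rootOf v) := by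
  induction v using F.induct with
  | h0 v h => rw [F.rootOf_of_none h]
  | h1 v w d h ih =>
    rw [F.rootOf_of_some h]
    exact (SimpleGraph.Adj.reachable (Or.inl ⟨d, h⟩)).trans ih

theorem reachable_iff (F : RForest D V) {v w : V} :
    F.graph.Reachable v w ↔ F.rootOf v = F.rootOf w := by
  refine ⟨F.rootOf_eq_of_reachable, fun h => ?_⟩
  have hv := F.reachable_rootOf v
  rw [h] at hv
  exact hv.trans (F.reachable_rootOf w).symm

/-- The relation between the lower and the upper end of an edge. -/
def Below (F : RForest D V) (w v : V) : Prop := ∃ d, F.parent v = some (w, d)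

theorem not_transGen_below_self (F : RForest D V) (v : V) : ¬ Relation.TransGen F.Below v v :=
  F.wf.transGen.irrefl.irrefl v

theorem eq_of_reflTransGen_below (F : RForest D V) {v w : V}
    (h : Relation.ReflTransGen F.Below v w) (h' : Relation.ReflTransGen F.Below w v) : v = w := by
  rcases Relation.reflTransGen_iff_eq_or_transGen.1 h with h1 | h1
  · exact h1.symm
  · exact absurd (h1.trans_left h') (F.not_transGen_below_self v)

variable [DecidableEq V]

theorem reflTransGen_rootOf_part (F : RForest D V) (e : Finset V) (v : V) :
    Relation.ReflTransGen F.Below ((F.part e).rootOf v) v := by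
  induction v using (F.part e).induct with
  | h0 v h => rw [(F.part e).rootOf_of_none h]
  | h1 v w d h ih =>
    rw [(F.part e).rootOf_of_some h]
    refine ih.tail ⟨d, ?_⟩
    by_cases hv : v ∈ e
    · simpa [part, hv] using h
    · simp [part, hv] at h

theorem graph_part_le (F : RForest D V) (e : Finset V) : (F.part e).graph ≤ F.graph := by
  have h1 : ∀ v w d, (F.part e).parent v = some (w, d) → F.parent v = some (w, d) := by
    intro v w d h
    by_cases hv : v ∈ e
    · simpa [part, hv] using h
    · simp [part, hv] at h
  rintro v w (⟨d, h⟩ | ⟨d, h⟩)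
  · exact Or.inl ⟨d, h1 _ _ _ h⟩
  · exact Or.inr ⟨d, h1 _ _ _ h⟩

theorem graph_part_adj (F : RForest D V) {e : Finset V} {v w : V} {d : D} (hv : v ∈ e)
    (h : F.parent v = some (w, d)) : (F.part e).graph.Adj v w :=
  Or.inl ⟨d, by simp [part, hv, h]⟩

variable [Fintype V]

/-- Without the edge from `v` down to `w`, the vertex `v` is a root. If `w` were still connected to
`v`, its root would be `v`, so `v` would lie below `w` and hence strictly below itself. -/
theorem isBridge_of_parent (F : RForest D V) {v w : V} {d : D} (h : F.parent v = some (w, d)) :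
    F.graph.IsBridge s(v, w) := by
  rw [SimpleGraph.isBridge_iff]
  intro hr
  have hle : F.graph.deleteEdges {s(v, w)} ≤ (F.part {v}ᶜ).graph := by
    intro x y hxy
    rw [SimpleGraph.deleteEdges_adj, Set.mem_singleton_iff] at hxy
    obtain ⟨⟨d', h'⟩ | ⟨d', h'⟩, hne⟩ := hxy
    · refine F.graph_part_adj (d := d') ?_ h'
      rw [Finset.mem_compl, Finset.mem_singleton]
      rintro rfl
      rw [h] at h'
      cases h'
      exact hne rfl
    · refine (F.graph_part_adj (d := d') ?_ h').symm
      rw [Finset.mem_compl, Finset.mem_singleton]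
      rintro rfl
      rw [h] at h'
      cases h'
      exact hne Sym2.eq_swap
  have h1 := (F.part {v}ᶜ).rootOf_eq_of_reachable (hr.mono hle)
  have h2 := F.reflTransGen_rootOf_part {v}ᶜ w
  rw [← h1, (F.part {v}ᶜ).rootOf_of_none (by simp [part])] at h2
  exact F.not_transGen_below_self v (Relation.TransGen.tail' h2 ⟨d, h⟩)

theorem isAcyclic_graph (F : RForest D V) : F.graph.IsAcyclic := by
  rw [SimpleGraph.isAcyclic_iff_forall_adj_isBridge]
  rintro v w (⟨d, h⟩ | ⟨d, h⟩)
  · exact F.isBridge_of_parent h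
  · rw [Sym2.eq_swap]
    exact F.isBridge_of_parent h

/-- Two vertices are in the same component of `Part_e(F)` iff the path between them uses only edges
in `e`. -/
theorem rootOf_part_eq_iff (F : RForest D V) (e : Finset V) {v w : V} (q : F.graph.Walk v w)
    (hq : q.IsPath) : (F.part e).rootOf v = (F.part e).rootOf w ↔
      ∀ u t d, F.parent u = some (t, d) → s(u, t) ∈ q.edges → u ∈ e := by
  rw [← reachable_iff]
  constructor
  · intro hr u t d hu hut
    obtain ⟨q', hq'⟩ := hr.exists_isPath
    have hmem : ∀ x ∈ q'.edges, x ∈ F.graph.edgeSet := fun x hx =>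
      SimpleGraph.edgeSet_mono (F.graph_part_le e) (q'.edges_subset_edgeSet hx)
    -- Paths in an acyclic graph are unique, so a path inside `Part_e(F)` is already the given path
    -- of `F`.
    have heq : q'.transfer F.graph hmem = q :=
      congrArg Subtype.val
        ((F.isAcyclic_graph.subsingleton_path v w).elim
          ⟨q'.transfer F.graph hmem, hq'.transfer hmem⟩ ⟨q, hq⟩)
    rw [← heq, SimpleGraph.Walk.edges_transfer] at hut
    have hadj : (F.part e).graph.Adj u t := q'.adj_of_mem_edges hut
    rcases hadj with ⟨d', h'⟩ | ⟨d', h'⟩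
    · by_contra hue
      simp [part, hue] at h'
    -- Here `t` would also have `u` as its lower end, so that `u` lies strictly below itself.
    · exfalso
      by_cases hte : t ∈ e
      · have h'' : F.parent t = some (u, d') := by simpa [part, hte] using h'
        exact F.not_transGen_below_self u (.tail (.single ⟨d', h''⟩) ⟨d, hu⟩)
      · simp [part, hte] at h'
  · intro h
    refine ⟨q.transfer _ fun x hx => ?_⟩
    induction x using Sym2.ind with | _ x y
    rw [SimpleGraph.mem_edgeSet]
    rcases q.adj_of_mem_edges hx with ⟨d, hd⟩ | ⟨d, hd⟩
    · exact F.graph_part_adj (h x y d hd hx) hd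
    · exact (F.graph_part_adj (h y x d hd (Sym2.eq_swap ▸ hx)) hd).symm

/-- A generalized partition is an ordered partition of the set of edges such that each block lies in
a component of the forest formed by the edges of this block and of the previous ones. -/
theorem isGenPartition_iff (F : RForest D V) {k : ℕ} (p : Fin k → Finset V) :
    F.IsGenPartition p ↔ (∀ i, (p i).Nonempty) ∧ (∀ i j, i ≠ j → Disjoint (p i) (p j)) ∧
      Finset.univ.biUnion p = F.edges ∧ ∀ i, ∀ u ∈ p i, ∀ v ∈ p i,
        (F.part ((Finset.Iic i).biUnion p)).rootOf u =
          (F.part ((Finset.Iic i).biUnion p)).rootOf v := by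
  constructor
  · intro h
    refine ⟨h.nonempty, h.disjoint, h.union, fun i u hu v hv => ?_⟩
    -- A shortest walk between the upper ends `u` and `v` uses only edges of blocks `j ≤ i`, so it
    -- stays inside the partial forest.
    obtain ⟨q, hq⟩ := (h.component i u hu v hv).exists_walk_length_eq_dist
    rw [F.rootOf_part_eq_iff _ q (q.isPath_of_length_eq_dist hq)]
    intro x t d hx hxt
    have hxe : x ∈ F.edges := by simp [mem_edges, hx]
    rw [← h.union, Finset.mem_biUnion] at hxe
    obtain ⟨j, -, hj⟩ := hxe
    rw [Finset.mem_biUnion]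
    exact ⟨j, Finset.mem_Iic.2 (h.path i u (Or.inl hu) v (Or.inl hv) q hq j x hj t d hx hxt), hj⟩
  · rintro ⟨h1, h2, h3, h4⟩
    refine ⟨h1, h2, h3, fun i u hu v hv => ?_, fun i v hv w hw q hq j u hu t d hut hmem => ?_⟩
    · exact ((reachable_iff _).2 (h4 i u hu v hv)).mono (F.graph_part_le _)
    · have hsub : p i ⊆ (Finset.Iic i).biUnion p :=
        Finset.subset_biUnion_of_mem p (Finset.mem_Iic.2 le_rfl)
      -- A lower end is joined to its upper end by an edge of the block itself, so it suffices to
      -- compare upper ends.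
      have hend : ∀ x ∈ F.ends (p i), ∃ y ∈ p i,
          (F.part ((Finset.Iic i).biUnion p)).rootOf x =
            (F.part ((Finset.Iic i).biUnion p)).rootOf y := by
        rintro x (hx | ⟨y, hy, d, hd⟩)
        · exact ⟨x, hx, rfl⟩
        · refine ⟨y, hy, ((F.part _).rootOf_of_some (d := d) ?_).symm⟩
          simp only [part, if_pos (hsub hy), hd]
      obtain ⟨y, hy, hvy⟩ := hend v hv
      obtain ⟨z, hz, hwz⟩ := hend w hw
      have hvw := hvy.trans ((h4 i y hy z hz).trans hwz.symm)
      have hmem' := (F.rootOf_part_eq_iff _ q (q.isPath_of_length_eq_dist hq)).1 hvw u t d hut hmem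
      obtain ⟨j', hj', hu'⟩ := Finset.mem_biUnion.1 hmem'
      by_cases hjj : j = j'
      · exact hjj ▸ Finset.mem_Iic.1 hj'
      · exact absurd hu' (Finset.disjoint_left.1 (h2 j j' hjj) hu)

/-- Removing the last block of a generalized partition. -/
theorem isGenPartition_snoc (F : RForest D V) {k : ℕ} (p : Fin k → Finset V) {g : Finset V}
    (hg : g ⊆ F.edges) :
    F.IsGenPartition (Fin.snoc (α := fun _ => Finset V) p (F.edges \ g)) ↔
      ((F.edges \ g).Nonempty ∧ ∀ u ∈ F.edges \ g, ∀ v ∈ F.edges \ g, F.rootOf u = F.rootOf v) ∧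
        (F.part g).IsGenPartition p := by
  rw [isGenPartition_iff, isGenPartition_iff, biUnion_snoc, F.edges_part,
    Finset.inter_eq_right.2 hg]
  have hpart : ∀ i, Finset.univ.biUnion p = g →
      (F.part g).part ((Finset.Iic i).biUnion p) = F.part ((Finset.Iic i).biUnion p) :=
    fun i h => F.part_part (h ▸ Finset.biUnion_subset_biUnion_of_subset_left p
      (Finset.subset_univ _))
  constructor
  · rintro ⟨h1, h2, h3, h4⟩
    have hdis : Disjoint (Finset.univ.biUnion p) (F.edges \ g) := by
      rw [Finset.disjoint_biUnion_left]
      intro i _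
      have := h2 i.castSucc (Fin.last k) (Fin.castSucc_lt_last i).ne
      rwa [Fin.snoc_castSucc, Fin.snoc_last] at this
    have hu : Finset.univ.biUnion p = g := by
      ext v
      have h3' := Finset.ext_iff.1 h3 v
      have hd : v ∈ Finset.univ.biUnion p → v ∉ F.edges \ g :=
        fun h => Finset.disjoint_left.1 hdis h
      have hgv := @hg v
      simp only [Finset.mem_union, Finset.mem_sdiff] at h3' hd
      tauto
    refine ⟨⟨?_, ?_⟩, fun i => ?_, fun i j hij => ?_, hu, fun i => ?_⟩
    · simpa using h1 (Fin.last k)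
    -- For the last index the blocks exhaust `E(F)`, so the condition concerns the components of `F`
    -- itself. For earlier indices the union stays inside `g` and does not see the last block.
    · have := h4 (Fin.last k)
      rwa [Fin.snoc_last, biUnion_Iic_last_snoc, h3, F.part_edges] at this
    · simpa using h1 i.castSucc
    · have := h2 i.castSucc j.castSucc (by simpa using hij)
      rwa [Fin.snoc_castSucc, Fin.snoc_castSucc] at this
    · have := h4 i.castSucc
      rwa [Fin.snoc_castSucc, biUnion_Iic_castSucc_snoc, ← hpart i hu] at this
  · rintro ⟨⟨h0, h0'⟩, h1, h2, h3, h4⟩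
    have hdis : ∀ i, Disjoint (p i) (F.edges \ g) := fun i =>
      Finset.disjoint_sdiff.mono_left (h3 ▸ Finset.subset_biUnion_of_mem p (Finset.mem_univ i))
    refine ⟨fun i => ?_, fun i j hij => ?_, ?_, fun i => ?_⟩
    · induction i using Fin.lastCases with
      | last => simpa using h0
      | cast i => simpa using h1 i
    · induction i using Fin.lastCases with
      | last =>
        induction j using Fin.lastCases with
        | last => exact absurd rfl hij
        | cast j => simpa using (hdis j).symm
      | cast i =>
        induction j using Fin.lastCases with
        | last => simpa using hdis i
        | cast j => simpa using h2 i j (by simpa using hij)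
    · rw [h3, Finset.union_sdiff_of_subset hg]
    · induction i using Fin.lastCases with
      | last =>
        rw [Fin.snoc_last, biUnion_Iic_last_snoc, h3, Finset.union_sdiff_of_subset hg,
          F.part_edges]
        exact h0'
      | cast i =>
        rw [Fin.snoc_castSucc, biUnion_Iic_castSucc_snoc, ← hpart i h3]
        exact h4 i

end Graph

/-! ### The tree of a block does not depend on the later blocks. -/

/-- Vertices without edges may be added to a forest. -/
theorem rcls_eq_of_embedding {D X Y : Type*} [Fintype X] [Fintype Y] {A : RForest D X}
    {B : RForest D Y} (f : X ↪ Y) (h : ∀ x, B.parent (f x) = (A.parent x).map (Prod.map f id))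
    (h' : ∀ y, y ∉ Set.range f → B.parent y = none) : A.rcls = B.rcls := by
  classical
  rw [← mul_one A.rcls, ← rcls_edgeless D {y // y ∉ Set.range f}, ← rcls_add]
  refine rcls_eq ⟨(Equiv.sumCongr (Equiv.ofInjective f f.injective) (Equiv.refl _)).trans
    (Equiv.sumCompl (· ∈ Set.range f)), ?_⟩
  rintro (x | y)
  · simp only [add, Sum.elim_inl, Option.map_map]
    refine (h x).trans ?_
    rcases A.parent x with _ | ⟨w, d⟩ <;> rfl
  · exact h' y.1 y.2

section Blocks

variable {D V : Type*} [DecidableEq V] [Fintype V]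

/-- For a block `s` in one component of `Part_g(F)`, contracting the other edges gives the same tree
for `F` and for `Part_g(F)`. -/
theorem rcls_cont_part (F : RForest D V) {g s : Finset V} (hg : g ⊆ F.edges) (hs : s ⊆ g)
    (hne : s.Nonempty) (hc : ∀ u ∈ s, ∀ v ∈ s, (F.part g).rootOf u = (F.part g).rootOf v) :
    (F.cont (F.edges \ s)).rcls = ((F.part g).cont (g \ s)).rcls := by
  obtain ⟨u₀, hu₀⟩ := hne
  set r := (F.part g).rootOf u₀ with hr
  set R := F.rootOf u₀ with hR
  have hrR : F.rootOf r = R := F.rootOf_part g u₀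
  have hRn : F.parent R = none := F.parent_rootOf u₀
  have hrn : (F.part g).parent r = none := (F.part g).parent_rootOf u₀
  have hsr : ∀ u ∈ s, (F.part g).rootOf u = r := fun u hu => hc u hu u₀ hu₀
  have hnone : ∀ v, v ∉ F.edges ↔ F.parent v = none := fun v => by
    rw [mem_edges, Option.not_isSome_iff_eq_none]
  have hRe : R ∉ F.edges := (hnone R).2 hRn
  have hrg : r ∉ g := fun h =>
    absurd (hg h) ((hnone r).2 (((F.part_parent_eq_none g r).1 hrn) h))
  have hpp : (F.part g).part (g \ s) = F.part (g \ s) := F.part_part Finset.sdiff_subset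
  have hX : ∀ v, (F.part (F.edges \ s)).parent v = none ↔ v ∉ F.edges ∨ v ∈ s := by
    intro v
    rw [part_parent_eq_none, ← hnone, Finset.mem_sdiff]
    tauto
  have hY : ∀ v, ((F.part g).part (g \ s)).parent v = none ↔ v ∉ g ∨ v ∈ s := by
    intro v
    have := @hg v
    rw [hpp, part_parent_eq_none, ← hnone, Finset.mem_sdiff]
    tauto
  -- The root of the component in `F` is sent to the root of the component in `Part_g(F)`.
  have hroot : (F.part (F.edges \ s)).rootOf r = R := by
    rcases (hX _).1 ((F.part (F.edges \ s)).parent_rootOf r) with h | h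
    · rw [← F.rootOf_of_none ((hnone _).1 h), F.rootOf_part, hrR]
    -- If `r` were contracted to a vertex of `s`, that vertex would lie below `r` and, having `r` as
    -- its root in `Part_g(F)`, also above `r`. It would equal `r`, which is not in `g ⊇ s`.
    · have h1 := F.reflTransGen_rootOf_part (F.edges \ s) r
      have h2 := F.reflTransGen_rootOf_part g ((F.part (F.edges \ s)).rootOf r)
      rw [hsr _ h] at h2
      rw [F.eq_of_reflTransGen_below h1 h2] at h
      exact absurd (hs h) hrg
  -- On the component of `r` in `Part_g(F)` the two contractions agree, once `R` is replaced by `r`: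
  -- going down, both stop at the first vertex of `s`, or else at their respective roots.
  have key : ∀ w, (F.part g).rootOf w = r →
      (if (F.part (F.edges \ s)).rootOf w = R then r else (F.part (F.edges \ s)).rootOf w) =
        ((F.part g).part (g \ s)).rootOf w := by
    intro w
    induction w using (F.part g).induct with
    | h0 w hw =>
      intro h
      rw [(F.part g).rootOf_of_none hw] at h
      rw [h, hroot, if_pos rfl, rootOf_of_none]
      exact (hY r).2 (Or.inl hrg)
    | h1 w x d hw ih =>
      intro h
      rw [(F.part g).rootOf_of_some hw] at h
      have hwg : w ∈ g := by
        by_contra hwg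
        simp [part, hwg] at hw
      have hwF : F.parent w = some (x, d) := by simpa [part, hwg] using hw
      by_cases hws : w ∈ s
      · rw [rootOf_of_none _ ((hX w).2 (Or.inr hws)), rootOf_of_none _ ((hY w).2 (Or.inr hws)),
          if_neg]
        rintro rfl
        exact hRe (hg hwg)
      · rw [(F.part (F.edges \ s)).rootOf_of_some (w := x) (d := d),
          ((F.part g).part (g \ s)).rootOf_of_some (w := x) (d := d)]
        · exact ih h
        · simp [part, hwg, hws, hwF]
        · simp [part, hg hwg, hws, hwF]
  -- This makes the map below injective: `r` can be a vertex of the contraction of `F` only if it is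
  -- `R` itself.
  have hrR' : ∀ v, v ∉ F.edges ∨ v ∈ s → v = r → v = R := by
    rintro v (h | h) rfl
    · rw [← hrR, F.rootOf_of_none ((hnone _).1 h)]
    · exact absurd (hs h) hrg
  -- The vertices that carry edges are those of `s` together with at most one root, `R` for `F` and
  -- `r` for `Part_g(F)`. So `f` sends `R` to `r` and fixes everything else.
  let f : F.ContVertex (F.edges \ s) ↪ (F.part g).ContVertex (g \ s) :=
    { toFun := fun v => ⟨if v.1 = R then r else v.1, by
        rw [hY]
        split_ifs
        · exact Or.inl hrg
        · exact ((hX v.1).1 v.2).imp_left fun h h' => h (hg h')⟩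
      inj' := by
        intro v w hvw
        have hvw' : (if v.1 = R then r else v.1) = if w.1 = R then r else w.1 :=
          congrArg Subtype.val hvw
        have h1 := hrR' v.1 ((hX _).1 v.2)
        have h2 := hrR' w.1 ((hX _).1 w.2)
        apply Subtype.ext
        split_ifs at hvw' with hv hw hw
        · rw [hv, hw]
        · rw [hv, h2 hvw'.symm]
        · rw [hw, h1 hvw']
        · exact hvw' }
  have hf : ∀ v, (f v).1 = if v.1 = R then r else v.1 := fun v => rfl
  refine rcls_eq_of_embedding f (fun v => ?_) fun y hy => ?_
  · change ((F.part g).parent (f v).1).map (Prod.map ((F.part g).toCont (g \ s)) id) =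
      ((F.parent v.1).map (Prod.map (F.toCont (F.edges \ s)) id)).map (Prod.map f id)
    rw [hf]
    by_cases hvR : v.1 = R
    · rw [if_pos hvR, hvR, hRn, hrn]
      rfl
    · rw [if_neg hvR]
      rcases (hX v.1).1 v.2 with h | h
      · rw [(hnone _).1 h, (F.part_parent_eq_none g _).2 fun _ => (hnone _).1 h]
        rfl
      · obtain ⟨⟨w, d⟩, hw⟩ := Option.isSome_iff_exists.1 (mem_edges.1 (hg (hs h)))
        have hw' : (F.part g).parent v.1 = some (w, d) := by simp [part, hs h, hw]
        have hwr : (F.part g).rootOf w = r := by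
          rw [← (F.part g).rootOf_of_some hw', hsr _ h]
        rw [hw, hw']
        simp only [Option.map_some, Prod.map_apply, id_eq, Option.some.injEq, Prod.mk.injEq,
          and_true]
        exact Subtype.ext (key w hwr).symm
  · change ((F.part g).parent y.1).map _ = none
    rw [Option.map_eq_none_iff, part_parent_eq_none]
    intro hyg
    rcases (hY y.1).1 y.2 with h | h
    · exact absurd hyg h
    · refine absurd ⟨⟨y.1, (hX _).2 (Or.inr h)⟩, Subtype.ext ?_⟩ hy
      rw [hf]
      refine if_neg ?_
      rintro h'
      exact hRe (h' ▸ hg hyg)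

end Blocks

end RForest

/-! ### The sum over generalized partitions satisfies the recursion on last letters. -/

section Formula

variable {K : Type*} [Field K] {D : Type*} (φ : (NTree D →₀ K) →ₗ[K] (D →₀ K))
variable {V : Type*} [Fintype V] [DecidableEq V]

/-- If `φ` does not vanish on `Cont_g(F)`, then the edges that are not in `g` are in one component
of `F`. -/
theorem connected_of_letter_cont_ne_zero (F : RForest D V) {g : Finset V}
    (h : letter φ (F.cont g).rcls ≠ 0) : (F.edges \ g).Nonempty ∧
      ∀ u ∈ F.edges \ g, ∀ v ∈ F.edges \ g, F.rootOf u = F.rootOf v := by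
  have h1 : (F.cont g).rcls.numTrees = 1 := by
    by_contra hc
    exact h (letter_of_numTrees_ne_one φ hc)
  rw [RClass.numTrees_rcls, RForest.fullRoots_card_eq_one] at h1
  obtain ⟨v₀, h₀, hv⟩ := h1
  have hroot : ∀ u ∈ F.edges \ g, F.rootOf u = F.rootOf v₀.1 := by
    intro u hu
    have hu' : (F.part g).parent u = none := by
      rw [RForest.part_parent_eq_none]
      exact fun h' => absurd h' (Finset.mem_sdiff.1 hu).2
    have := hv ⟨u, hu'⟩ ((F.mem_edges_cont g _).2 hu)
    have h2 := congrArg Subtype.val this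
    rwa [RForest.rootOf_cont, RForest.rootOf_cont] at h2
  exact ⟨⟨v₀.1, (F.mem_edges_cont g v₀).1 h₀⟩,
    fun u hu v hv => (hroot u hu).trans (hroot v hv).symm⟩

/-- The word given by a tuple of sets of edges. -/
noncomputable def blockWord (F : RForest D V) {k : ℕ} (p : Fin k → Finset V) : Sh K D :=
  Sh.concat K (List.ofFn fun i => letter φ (F.cont (F.edges \ p i)).rcls)

open Classical in
/-- The sum of the words given by the generalized partitions with `k` blocks. -/
noncomputable def genPartitionSum (k : ℕ) (F : RForest D V) : Sh K D :=
  ∑ p : Fin k → Finset V with F.IsGenPartition p, blockWord φ F p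

/-- The complement of the last block is `g`, which yields the last letter; by `rcls_cont_part`, the
earlier letters are the same for `F` and for `Part_g(F)`. -/
theorem blockWord_snoc (F : RForest D V) {k : ℕ} {p : Fin k → Finset V} {g : Finset V}
    (hg : g ⊆ F.edges) (hp : (F.part g).IsGenPartition p) :
    blockWord φ F (Fin.snoc (α := fun _ => Finset V) p (F.edges \ g)) =
      Sh.snocL (letter φ (F.cont g).rcls) (blockWord φ (F.part g) p) := by
  have he : (F.part g).edges = g := by rw [F.edges_part, Finset.inter_eq_right.2 hg]
  rw [blockWord, List.ofFn_succ', List.concat_eq_append, Sh.concat_append_singleton, Fin.snoc_last,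
    Finset.sdiff_sdiff_eq_self hg, blockWord]
  congr 3
  funext i
  have hi : p i ⊆ g := by
    have := Finset.subset_biUnion_of_mem p (Finset.mem_univ i)
    rwa [hp.union, he] at this
  rw [Fin.snoc_castSucc, he, F.rcls_cont_part hg hi (hp.nonempty i)]
  exact fun u hu v hv => RForest.rootOf_eq_of_reachable _ (hp.component i u hu v hv)

/-- The set `g` is the complement of the last block. The sum may run over all `g`, because the
letter of `Cont_g(F)` vanishes when `E(F) \ g` is not an admissible last block. -/
theorem genPartitionSum_succ (k : ℕ) (F : RForest D V) :
    genPartitionSum φ (k + 1) F = ∑ g ∈ F.edges.powerset,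
      Sh.snocL (letter φ (F.cont g).rcls) (genPartitionSum φ k (F.part g)) := by
  classical
  rw [← Finset.sum_filter_of_ne (p := fun g => (F.edges \ g).Nonempty ∧
    ∀ u ∈ F.edges \ g, ∀ v ∈ F.edges \ g, F.rootOf u = F.rootOf v)]
  swap
  · intro g _ h
    refine connected_of_letter_cont_ne_zero φ F fun h' => h ?_
    rw [h', map_zero, LinearMap.zero_apply]
  simp only [genPartitionSum, map_sum]
  rw [Finset.sum_sigma']
  have hlast : ∀ p : Fin (k + 1) → Finset V, F.IsGenPartition p →
      Fin.snoc (α := fun _ => Finset V) (Fin.init p) (F.edges \ (F.edges \ p (Fin.last k))) =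
        p := by
    intro p hp
    have : p (Fin.last k) ⊆ F.edges :=
      hp.union ▸ Finset.subset_biUnion_of_mem p (Finset.mem_univ _)
    rw [Finset.sdiff_sdiff_eq_self this]
    exact Fin.snoc_init_self p
  refine Finset.sum_bij' (fun p _ => ⟨F.edges \ p (Fin.last k), Fin.init p⟩)
    (fun x _ => Fin.snoc (α := fun _ => Finset V) x.2 (F.edges \ x.1)) ?_ ?_ ?_ ?_ ?_
  · intro p hp
    rw [Finset.mem_filter_univ] at hp
    simp only [Finset.mem_sigma, Finset.mem_filter, Finset.mem_powerset, Finset.mem_univ, true_and]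
    rw [and_assoc]
    refine ⟨Finset.sdiff_subset, ?_⟩
    rw [← F.isGenPartition_snoc _ Finset.sdiff_subset, hlast p hp]
    exact hp
  · rintro ⟨g, p⟩ h
    simp only [Finset.mem_sigma, Finset.mem_filter, Finset.mem_powerset, Finset.mem_univ,
      true_and] at h ⊢
    rw [F.isGenPartition_snoc _ h.1.1]
    exact ⟨h.1.2, h.2⟩
  · intro p hp
    rw [Finset.mem_filter_univ] at hp
    exact hlast p hp
  · rintro ⟨g, p⟩ h
    simp only [Finset.mem_sigma, Finset.mem_filter, Finset.mem_powerset] at h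
    simp [Finset.sdiff_sdiff_eq_self h.1.1]
  · intro p hp
    rw [Finset.mem_filter_univ] at hp
    have h := hlast p hp
    rw [← h, F.isGenPartition_snoc _ Finset.sdiff_subset] at hp
    simp only
    rw [← blockWord_snoc φ F Finset.sdiff_subset hp.2, h]

/-- The empty tuple covers `E(F)` only if there are no edges, so the case `k = 0` reproduces the
counit term of the recursion. -/
theorem genPartitionSum_zero (F : RForest D V) :
    genPartitionSum φ 0 F = if F.edges = ∅ then 1 else 0 := by
  classical
  have h : ∀ p : Fin 0 → Finset V, F.IsGenPartition p ↔ F.edges = ∅ := by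
    intro p
    rw [F.isGenPartition_iff]
    simp [eq_comm]
  rw [genPartitionSum, Finset.sum_filter, Finset.univ_unique, Finset.sum_singleton]
  simp only [h]
  rfl

-- Induction through the recursion on last letters. The term `g = E(F)` vanishes because `Cont_g(F)`
-- is `1`, and for every other `g` the forest `Part_g(F)` has fewer edges.
variable {φ} in
theorem Lifts.eq_sum_genPartitionSum {Φ : CCK K D →ₐc[K] Sh K D} (h : Lifts φ Φ) (n : ℕ)
    (F : RForest D V) (hn : F.edges.card ≤ n) :
    Φ (F.toCCK K) = ∑ k ∈ Finset.range (n + 1), genPartitionSum φ k F := by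
  induction n generalizing F with
  | zero =>
    rw [Nat.le_zero, Finset.card_eq_zero] at hn
    have hc := F.rcls_cont_edges
    rw [hn] at hc
    rw [h.snocL_rec, hn]
    simp [genPartitionSum_zero, hn, hc, letter_one]
  | succ n ih =>
    rw [h.snocL_rec, Finset.sum_range_succ', genPartitionSum_zero, add_comm]
    congr 1
    simp only [genPartitionSum_succ]
    rw [Finset.sum_comm]
    refine Finset.sum_congr rfl fun g hg => ?_
    rw [Finset.mem_powerset] at hg
    rw [← map_sum]
    by_cases hgE : g = F.edges
    · rw [hgE, F.rcls_cont_edges, letter_one, map_zero, LinearMap.zero_apply,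
        LinearMap.zero_apply]
    · rw [ih]
      rw [F.edges_part, Finset.inter_eq_right.2 hg]
      have := Finset.card_lt_card (Finset.ssubset_iff_subset_ne.2 ⟨hg, hgE⟩)
      omega

theorem sum_concat_blockTree (k : ℕ) (F : RForest D V) :
    ∑ p : {p : Fin k → Finset V // F.IsGenPartition p},
      Sh.concat K (List.ofFn fun i => φ (Finsupp.single (F.blockTree p.2 i) 1)) =
        genPartitionSum φ k F := by
  classical
  refine Eq.trans (Finset.sum_congr rfl fun p _ => ?_)
    (Finset.sum_subtype _ (fun p => Finset.mem_filter_univ p) (blockWord φ F)).symm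
  rw [blockWord]
  congr 2
  funext i
  exact (letter_tree φ (F.blockTree p.2 i)).symm

end Formula

end ContractionForest

theorem mainTheorem12 {K : Type*} [Field K] [CharZero K] {D : Type*} [Nonempty D]
    (φ : (ContractionForest.NTree D →₀ K) →ₗ[K] (D →₀ K)) :
    (∃! Φ : ContractionForest.CCK K D →ₐc[K] ContractionForest.Sh K D,
      ContractionForest.Lifts φ Φ) ∧
    ∀ Φ : ContractionForest.CCK K D →ₐc[K] ContractionForest.Sh K D,
      ContractionForest.Lifts φ Φ →
      ∀ {V : Type*} [Fintype V] [DecidableEq V] (F : ContractionForest.RForest D V),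
        F.edges.Nonempty →
        Φ (F.toCCK K) =
          ∑ k ∈ Finset.Icc 1 F.edges.card,
            ∑ p : {p : Fin k → Finset V // F.IsGenPartition p},
              ContractionForest.Sh.concat K
                (List.ofFn fun i => φ (Finsupp.single (F.blockTree p.2 i) 1)) := by
  refine ⟨⟨ContractionForest.solutionHom φ, ContractionForest.lifts_solutionHom φ,
    fun Φ h => h.eq_solutionHom⟩, fun Φ h V _ _ F hF => ?_⟩
  simp only [ContractionForest.sum_concat_blockTree]
  -- The term `k = 0` is the counit of `F`, which is `0` since `F` has an edge; what remains runs
  -- from `1` to the number of edges.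
  rw [h.eq_sum_genPartitionSum _ F le_rfl, Finset.range_eq_Ico, Finset.sum_eq_sum_Ico_succ_bot
    (Nat.succ_pos _), ContractionForest.genPartitionSum_zero, if_neg hF.ne_empty, zero_add]
  rfl
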